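/- Let $(M,g_M)$ be a smooth $m$-dimensional Riemannian manifold (Hausdorff, $\sigma$-compact, without boundary) and let $D\subset M$ be a bounded domain, i.e. a connected open set with compact closure, whose boundary $\partial D$ is non-empty. A map $f:D\to\mathbb R^n$ is called minimal if it is smooth and its graph $\{(x,f(x)):x\in D\}$ is a minimal submanifold of the Riemannian product $M\times\mathbb R^n$, i.e. the first variation of its $m$-dimensional area vanishes for every smooth variation with compact support. For $x\in D$ let $\lambda_1\ge\cdots\ge\lambda_m\ge 0$ denote the singular values of $df_x:(T_xM,g_M)\to\mathbb R^n$, i.e. the square roots of the eigenvalues, counted with multiplicity, of $(df_x)^{T}df_x$. Let $f_0,f_1:\overline D\to\mathbb R^n$ be continuous maps whose restrictions to $D$ are minimal maps, and suppose $f_0=f_1$ on $\partial D$. Then $f_0=f_1$ on $\overline D$ if at least one of the following holds: 1. $f_0$ and $f_1$ are both length non-increasing, i.e. for both maps all singular values satisfy $\lambda_i\le 1$ at every point of $D$; 2. for both maps $\sum_{i=1}^m\lambda_i\le 2$ at every point of $D$; 3. for both maps $\sum_{i=1}^m\lambda_i^2\le 2$ at every point of $D$; 4. for both maps $\sum_{i=1}^m(1+\lambda_i^2)^{1/2}\le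 2$ at every point of $D$. -/

import Mathlib

open Set Filter Topology MeasureTheory Manifold Bundle
open scoped ContDiff

attribute [local instance 2000] chartedSpaceSelf

noncomputable section

/-- The model space `ℝᵏ` with its Euclidean inner product. -/
abbrev Euc (k : ℕ) : Type := EuclideanSpace ℝ (Fin k)

section Riemannian

variable {m : ℕ} {M : Type*} [TopologicalSpace M] [ChartedSpace (Euc m) M]

instance tangentSpace_finiteDimensional (x : M) :
    FiniteDimensional ℝ (TangentSpace 𝓘(ℝ, Euc m) x) :=
  inferInstanceAs (FiniteDimensional ℝ (Euc m))

variable [RiemannianBundle (fun x : M => TangentSpace 𝓘(ℝ, Euc m) x)]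

/-- The coordinate vector field `∂/∂xⁱ` of the chart at `c`, at the point of `M` with coordinates
`y`. -/
def coordVector (c : M) (y : Euc m) (i : Fin m) :
    TangentSpace 𝓘(ℝ, Euc m) ((chartAt (Euc m) c).symm y) :=
  mfderiv 𝓘(ℝ, Euc m) 𝓘(ℝ, Euc m) (chartAt (Euc m) c).symm y
    (EuclideanSpace.single i (1 : ℝ) : Euc m)

/-- The matrix `g_ij = g_M(∂/∂xⁱ, ∂/∂xʲ)` of the metric of `M` in the chart at `c`. -/
def chartMetric (c : M) (y : Euc m) : Matrix (Fin m) (Fin m) ℝ :=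
  Matrix.of fun i j => inner ℝ (coordVector c y i) (coordVector c y j)

/-- The Riemannian volume on the domain of the chart at `c` (extended by zero to `M`):
`√(det g_ij) dx¹ ⋯ dxᵐ`, transported from the target of the chart to `M`. -/
def chartVolume [MeasurableSpace M] (c : M) : Measure M :=
  (((volume : Measure (Euc m)).restrict (chartAt (Euc m) c).target).withDensity
    (fun y => ENNReal.ofReal (Real.sqrt (chartMetric c y).det))).map (chartAt (Euc m) c).symm

variable (m M) in
/-- A smooth partition of unity on `M`, indexed by the points of `M` and subordinate to the
domains of the charts at these points. -/
def chartPartition [IsManifold 𝓘(ℝ, Euc m) ∞ M] [T2Space M] [SigmaCompactSpace M] :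
    SmoothPartitionOfUnity M 𝓘(ℝ, Euc m) M univ :=
  (SmoothPartitionOfUnity.exists_isSubordinate_chartAt_source 𝓘(ℝ, Euc m) M).choose

variable (m M) in
/-- The Riemannian volume measure `dv_M`, glued from the volumes in the charts by a partition of
unity: `dv_M = ∑_c ρ_c √(det g_ij) dx¹ ⋯ dxᵐ`. By the change of variables formula it does not
depend on the partition of unity. -/
def riemannianVolume [IsManifold 𝓘(ℝ, Euc m) ∞ M] [T2Space M] [SigmaCompactSpace M]
    [MeasurableSpace M] : Measure M :=
  Measure.sum fun c : M =>
    (chartVolume (m := m) c).withDensity fun x => ENNReal.ofReal (chartPartition m M c x)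

variable {n : ℕ}

/-- The differential `df : T_x M → ℝⁿ` of a map `f : M → ℝⁿ`. -/
def mapDifferential (f : M → Euc n) (x : M) : TangentSpace 𝓘(ℝ, Euc m) x →L[ℝ] Euc n :=
  mfderiv 𝓘(ℝ, Euc m) 𝓘(ℝ, Euc n) f x

/-- For a map `X = (p, h) : M → M × ℝⁿ`, the matrix
`⟨dX(a_i), dX(a_j)⟩ = g_M(dp(a_i), dp(a_j)) + ⟨dh(a_i), dh(a_j)⟩` at `x` of the pull-back of the
product metric, with respect to an orthonormal basis `a_i` of `(T_x M, g_M)`. -/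
def pullbackMetric (p : M → M) (h : M → Euc n) (x : M) :
    Matrix (Fin (Module.finrank ℝ (TangentSpace 𝓘(ℝ, Euc m) x)))
      (Fin (Module.finrank ℝ (TangentSpace 𝓘(ℝ, Euc m) x))) ℝ :=
  let a := stdOrthonormalBasis ℝ (TangentSpace 𝓘(ℝ, Euc m) x)
  let dp := mfderiv 𝓘(ℝ, Euc m) 𝓘(ℝ, Euc m) p x
  let dh := mapDifferential (m := m) h x
  Matrix.of fun i j => inner ℝ (dp (a i)) (dp (a j)) + inner ℝ (dh (a i)) (dh (a j))

/-- The `m`-dimensional area of the map `X = (p, h) : M → M × ℝⁿ` over the set `K ⊆ M`, that is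
`∫_K √(det ⟨dX(a_i), dX(a_j)⟩) dv_M`. -/
def mapArea [IsManifold 𝓘(ℝ, Euc m) ∞ M] [T2Space M] [SigmaCompactSpace M] [MeasurableSpace M]
    (K : Set M) (p : M → M) (h : M → Euc n) : ℝ :=
  ∫ x in K, Real.sqrt (pullbackMetric (m := m) p h x).det ∂(riemannianVolume m M)

/-- A smooth variation `X_t = (p t, h t) : D → M × ℝⁿ` of the graph `x ↦ (x, f x)` over `D` which
is fixed outside the compact set `K ⊆ D`. The submanifold may be moved in all directions of
`M × ℝⁿ`. -/
structure IsGraphVariation (D : Set M) (f : M → Euc n) (K : Set M)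
    (p : ℝ → M → M) (h : ℝ → M → Euc n) : Prop where
  isCompact : IsCompact K
  subset : K ⊆ D
  smooth_fst : ContMDiffOn (𝓘(ℝ, ℝ).prod 𝓘(ℝ, Euc m)) 𝓘(ℝ, Euc m) ∞
    (fun q : ℝ × M => p q.1 q.2) (univ ×ˢ D)
  smooth_snd : ContMDiffOn (𝓘(ℝ, ℝ).prod 𝓘(ℝ, Euc m)) 𝓘(ℝ, Euc n) ∞
    (fun q : ℝ × M => h q.1 q.2) (univ ×ˢ D)
  zero : ∀ x ∈ D, p 0 x = x ∧ h 0 x = f x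
  fixed : ∀ t, ∀ x ∈ D \ K, p t x = x ∧ h t x = f x

/-- `f : D → ℝⁿ` is a minimal map: it is smooth on `D` and its graph is a minimal submanifold of
`M × ℝⁿ`, i.e. a critical point of the area under all smooth variations with compact support. -/
structure IsMinimalMap [IsManifold 𝓘(ℝ, Euc m) ∞ M] [T2Space M] [SigmaCompactSpace M]
    [MeasurableSpace M] (D : Set M) (f : M → Euc n) : Prop where
  smooth : ContMDiffOn 𝓘(ℝ, Euc m) 𝓘(ℝ, Euc n) ∞ f D
  stationary : ∀ (K : Set M) (p : ℝ → M → M) (h : ℝ → M → Euc n),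
    IsGraphVariation (m := m) D f K p h →
      HasDerivAt (fun t => mapArea (m := m) K (p t) (h t)) 0 0

/-- The singular values `λ_1 ≥ ⋯ ≥ λ_m ≥ 0` of `df : (T_x M, g_M) → ℝⁿ` at the point `x`. -/
def mapSingularValue (f : M → Euc n) (x : M) (i : Fin m) : ℝ :=
  (mapDifferential (m := m) f x).toLinearMap.singularValues i

end Riemannian

end

/-! Write F(A) = √det(1 + AᵀA) for the area density of the graph of a linear map A (`gramDensity` in
an orthonormal basis). F is not convex on all linear maps, but its second derivative is nonnegative
along segments that stay in suitable convex sets of maps. Expanding that derivative in singular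
vectors (`secondVariation_eq`) gives three pieces: a normal part that is always nonnegative,
off-diagonal pairs controlled by λ_iλ_j ≤ 1, and the quadratic form `diagonalForm`. The last is
nonnegative if all λ_i ≤ 1, or if λ_i² ∑_{j≠i} λ_j² ≤ 1 for every i.

Conditions 1, 2 and 3 bound the operator, nuclear and Frobenius norms, so they persist on the
segment between two admissible differentials, and each gives one of these two criteria. Condition 4
forces A = 0 when m ≥ 2, and when m ≤ 1 the second criterion is empty. Degenerate directions can
occur only at borderline maps, and a nontrivial segment cannot stay borderline, because the squared
norm is strictly convex along it. Hence dF is strictly monotone on each class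
(`fderiv_gramDensity_mono`).

Both maps satisfy the weak Euler-Lagrange equation of F. Testing the difference of the two equations
with w = f₁ - f₀, cut off near its zeros to have compact support in D, and removing the cutoff,
gives ∫ (dF(df₁) - dF(df₀))(dw) = 0 over {w ≠ 0} (`setIntegral_indicator_sub_eq_zero`). Monotonicity
makes the integrand nonnegative, so it vanishes, and strictness gives dw = 0 where w ≠ 0. Then w is
locally constant there, and connectedness together with w = 0 on the nonempty frontier gives w = 0.
-/

/-! ### Derivatives of determinants, inverses and traces along curves of matrices. -/

section MatrixCalculus

variable {ι : Type*} [Fintype ι] [DecidableEq ι]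

attribute [local instance] Matrix.linftyOpNormedRing Matrix.linftyOpNormedAlgebra

lemma Matrix.hasDerivAt_entry {M : ℝ → Matrix ι ι ℝ} {M' : Matrix ι ι ℝ} {t : ℝ}
    (h : HasDerivAt M M' t) (i j : ι) : HasDerivAt (fun s => M s i j) (M' i j) t :=
  (LinearMap.toContinuousLinearMap
    (Matrix.entryLinearMap ℝ ℝ i j)).hasFDerivAt.comp_hasDerivAt t h

lemma Matrix.hasDerivAt_of_entry {M : ℝ → Matrix ι ι ℝ} {M' : Matrix ι ι ℝ} {t : ℝ}
    (h : ∀ i j, HasDerivAt (fun s => M s i j) (M' i j) t) : HasDerivAt M M' t := by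
  have h2 : HasDerivAt (fun s => (fun i j => M s i j : ι → ι → ℝ)) (fun i j => M' i j) t :=
    hasDerivAt_pi.2 fun i => hasDerivAt_pi.2 fun j => h i j
  exact (LinearMap.toContinuousLinearMap
    (Matrix.ofLinearEquiv ℝ : (ι → ι → ℝ) ≃ₗ[ℝ] Matrix ι ι ℝ).toLinearMap).hasFDerivAt.comp_hasDerivAt
      t h2

lemma Matrix.differentiable_det :
    Differentiable ℝ (fun M : ι → ι → ℝ => (Matrix.of M).det) := by
  simp only [Matrix.det_apply, Matrix.of_apply]
  refine ContDiff.differentiable (n := 1) (ContDiff.sum fun σ _ =>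
    ContDiff.const_smul _ (contDiff_prod fun i _ => ?_)) one_ne_zero
  fun_prop

/-- Jacobi's formula. -/
lemma Matrix.hasDerivAt_det {M : ℝ → Matrix ι ι ℝ} {M' : Matrix ι ι ℝ} {t : ℝ}
    (h : ∀ i j, HasDerivAt (fun s => M s i j) (M' i j) t) (hM : IsUnit (M t).det) :
    HasDerivAt (fun s => (M s).det) ((M t).det * ((M t)⁻¹ * M').trace) t := by
  -- By the chain rule only the value and the velocity of the curve matter, so the curve may be
  -- replaced by its tangent line, on which det(1 + sN) = 1 + s tr N + O(s²).
  have key : ∀ (N : ℝ → Matrix ι ι ℝ) (r : ℝ), N r = M t →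
      (∀ i j, HasDerivAt (fun s => N s i j) (M' i j) r) →
      HasDerivAt (fun s => (N s).det)
        (fderiv ℝ (fun M : ι → ι → ℝ => (Matrix.of M).det) (fun i j => M t i j)
          (fun i j => M' i j)) r := by
    intro N r hr hN
    have h2 : HasDerivAt (fun s => (fun i j => N s i j : ι → ι → ℝ)) (fun i j => M' i j) r :=
      hasDerivAt_pi.2 fun i => hasDerivAt_pi.2 fun j => hN i j
    have h3 := (Matrix.differentiable_det (fun i j => N r i j)).hasFDerivAt.comp_hasDerivAt r h2
    rw [hr] at h3
    exact h3
  refine (key M t rfl h).congr_deriv ?_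
  have h2 := key (fun s => M t + s • M') 0 (by simp) fun i j => by
    simpa using ((hasDerivAt_id (0 : ℝ)).mul_const (M' i j)).const_add (M t i j)
  have h3 : ∀ s : ℝ, (M t + s • M').det = (M t).det * (1 + ((M t)⁻¹ * M').trace * s +
      Polynomial.eval s (1 + (Polynomial.X : Polynomial ℝ) •
        ((M t)⁻¹ * M').map ⇑Polynomial.C).det.divX.divX * s ^ 2) := by
    intro s
    rw [← Matrix.det_one_add_smul, ← Matrix.det_mul, mul_add, mul_one, Matrix.mul_smul,
      Matrix.mul_nonsing_inv_cancel_left _ _ hM]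
  have h4 : HasDerivAt (fun s : ℝ => (M t + s • M').det)
      ((M t).det * ((M t)⁻¹ * M').trace) 0 := by
    simp only [h3]
    generalize (1 + (Polynomial.X : Polynomial ℝ) •
        ((M t)⁻¹ * M').map ⇑Polynomial.C).det.divX.divX = q
    refine ((((hasDerivAt_id (0 : ℝ)).const_mul ((M t)⁻¹ * M').trace).const_add 1).add
      ((q.hasDerivAt 0).mul ((hasDerivAt_id (0 : ℝ)).pow 2))).const_mul (M t).det
        |>.congr_deriv ?_
    simp
  exact h2.unique h4

lemma Matrix.hasDerivAt_inv {M : ℝ → Matrix ι ι ℝ} {M' : Matrix ι ι ℝ} {t : ℝ}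
    (h : HasDerivAt M M' t) (hM : IsUnit (M t).det) :
    HasDerivAt (fun s => (M s)⁻¹) (-((M t)⁻¹ * M' * (M t)⁻¹)) t := by
  obtain ⟨u, hu⟩ := (Matrix.isUnit_iff_isUnit_det _).2 hM
  have h1 := hasFDerivAt_ringInverse (𝕜 := ℝ) u
  rw [hu] at h1
  have h2 := h1.comp_hasDerivAt t h
  have h3 : ((↑u⁻¹ : Matrix ι ι ℝ)) = (M t)⁻¹ := by
    rw [← hu, Matrix.coe_units_inv]
  simp only [Matrix.nonsing_inv_eq_ringInverse]
  rw [h3] at h2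
  refine h2.congr_deriv ?_
  simp [Matrix.nonsing_inv_eq_ringInverse]

lemma Matrix.hasDerivAt_trace_inv_mul {M N : ℝ → Matrix ι ι ℝ} {M' N' : Matrix ι ι ℝ} {t : ℝ}
    (h : HasDerivAt M M' t) (hN : HasDerivAt N N' t) (hM : IsUnit (M t).det) :
    HasDerivAt (fun s => ((M s)⁻¹ * N s).trace)
      (((M t)⁻¹ * N').trace - ((M t)⁻¹ * M' * (M t)⁻¹ * N t).trace) t := by
  have h1 := (Matrix.hasDerivAt_inv h hM).mul hN
  refine (LinearMap.toContinuousLinearMap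
    (Matrix.traceLinearMap ι ℝ ℝ)).hasFDerivAt.comp_hasDerivAt t h1 |>.congr_deriv ?_
  change (-((M t)⁻¹ * M' * (M t)⁻¹) * N t + (M t)⁻¹ * N').trace = _
  rw [Matrix.trace_add, neg_mul, Matrix.trace_neg]
  ring

end MatrixCalculus

/-! ### The area density and its first two derivatives along lines. -/

section GramDensity

variable {ι : Type*} [Fintype ι] [DecidableEq ι]
  {W : Type*} [NormedAddCommGroup W] [InnerProductSpace ℝ W]

/-- The area density `√det(δ_ij + ⟨a_i, a_j⟩)` of the graph of the linear map sending the vectors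
of an orthonormal basis to the `a_i`. -/
noncomputable def gramDensity (a : ι → W) : ℝ := √(1 + Matrix.gram ℝ a).det

lemma one_add_gram_det_pos (a : ι → W) : 0 < (1 + Matrix.gram ℝ a).det :=
  (Matrix.PosDef.one.add_posSemidef (Matrix.posSemidef_gram ℝ a)).det_pos

lemma gramDensity_pos (a : ι → W) : 0 < gramDensity a := Real.sqrt_pos.2 (one_add_gram_det_pos a)

lemma contDiff_gramDensity : ContDiff ℝ ∞ (gramDensity : (ι → W) → ℝ) := by
  refine ContDiff.sqrt ?_ fun a => (one_add_gram_det_pos a).ne'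
  simp only [Matrix.det_apply]
  refine ContDiff.sum fun σ _ => ContDiff.const_smul _ (contDiff_prod fun i _ => ?_)
  simp only [Matrix.add_apply, Matrix.gram_apply]
  exact contDiff_const.add ((contDiff_apply ℝ W _).inner ℝ (contDiff_apply ℝ W _))

/-- The first derivative of the matrix `⟨a_i + t b_i, a_j + t b_j⟩`. -/
noncomputable def gramVariation (a b : ι → W) (t : ℝ) : Matrix ι ι ℝ :=
  Matrix.of fun i j => inner ℝ (a i + t • b i) (b j) + inner ℝ (b i) (a j + t • b j)

attribute [local instance] Matrix.linftyOpNormedRing Matrix.linftyOpNormedAlgebra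

lemma hasDerivAt_one_add_gram (a b : ι → W) (t : ℝ) :
    HasDerivAt (fun s : ℝ => 1 + Matrix.gram ℝ (a + s • b)) (gramVariation a b t) t := by
  refine Matrix.hasDerivAt_of_entry fun i j => ?_
  have h : ∀ k, HasDerivAt (fun s : ℝ => a k + s • b k) (b k) t := fun k => by
    simpa using ((hasDerivAt_id t).smul_const (b k)).const_add (a k)
  simpa [gramVariation, Matrix.gram_apply] using ((h i).inner ℝ (h j)).const_add
    ((1 : Matrix ι ι ℝ) i j)

lemma hasDerivAt_gramVariation (a b : ι → W) (t : ℝ) :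
    HasDerivAt (gramVariation a b) (Matrix.of fun i j => 2 * inner ℝ (b i) (b j)) t := by
  refine Matrix.hasDerivAt_of_entry fun i j => ?_
  have h : ∀ k, HasDerivAt (fun s : ℝ => a k + s • b k) (b k) t := fun k => by
    simpa using ((hasDerivAt_id t).smul_const (b k)).const_add (a k)
  simp only [gramVariation, Matrix.of_apply]
  refine ((h i).inner ℝ (hasDerivAt_const t (b j))).add
    ((hasDerivAt_const t (b i)).inner ℝ (h j)) |>.congr_deriv ?_
  simp; ring

lemma hasDerivAt_gramDensity_line (a b : ι → W) (t : ℝ) :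
    HasDerivAt (fun s : ℝ => gramDensity (a + s • b))
      (gramDensity (a + t • b) / 2 *
        ((1 + Matrix.gram ℝ (a + t • b))⁻¹ * gramVariation a b t).trace) t := by
  have hp := one_add_gram_det_pos (a + t • b)
  refine (Matrix.hasDerivAt_det (Matrix.hasDerivAt_entry (hasDerivAt_one_add_gram a b t))
    (isUnit_iff_ne_zero.2 hp.ne')).sqrt hp.ne' |>.congr_deriv ?_
  have hs : gramDensity (a + t • b) * gramDensity (a + t • b) =
    (1 + Matrix.gram ℝ (a + t • b)).det := Real.mul_self_sqrt hp.le
  have hs0 := gramDensity_pos (a + t • b)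
  change _ / (2 * gramDensity (a + t • b)) = _
  rw [← hs]
  field_simp

lemma fderiv_gramDensity_apply (a b : ι → W) (t : ℝ) :
    fderiv ℝ gramDensity (a + t • b) b = gramDensity (a + t • b) / 2 *
        ((1 + Matrix.gram ℝ (a + t • b))⁻¹ * gramVariation a b t).trace := by
  have hline : HasDerivAt (fun s : ℝ => a + s • b) b t := by
    simpa using ((hasDerivAt_id t).smul_const b).const_add a
  have h := ((contDiff_gramDensity (ι := ι) (W := W)).differentiable (by simp)
    (a + t • b)).hasFDerivAt.comp_hasDerivAt t hline
  exact h.unique (hasDerivAt_gramDensity_line a b t)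

lemma hasDerivAt_gramDensity_line' (a b : ι → W) (t : ℝ) :
    HasDerivAt (fun s : ℝ => gramDensity (a + s • b))
      (fderiv ℝ gramDensity (a + t • b) b) t := by
  rw [fderiv_gramDensity_apply]
  exact hasDerivAt_gramDensity_line a b t

/-- The second derivative of the area density along a line. -/
lemma hasDerivAt_fderiv_gramDensity_line (a b : ι → W) (t : ℝ) {d : ι → ℝ}
    (hd : 1 + Matrix.gram ℝ (a + t • b) = Matrix.diagonal d) :
    HasDerivAt (fun s : ℝ => fderiv ℝ gramDensity (a + s • b) b)
      (gramDensity (a + t • b) *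
        ((∑ i, gramVariation a b t i i / d i) ^ 2 / 4 -
          (∑ i, ∑ j, gramVariation a b t i j * gramVariation a b t j i / (d i * d j)) / 2 +
          ∑ i, ‖b i‖ ^ 2 / d i)) t := by
  have hp := one_add_gram_det_pos (a + t • b)
  simp only [fderiv_gramDensity_apply]
  refine ((hasDerivAt_gramDensity_line a b t).div_const 2).mul
    (Matrix.hasDerivAt_trace_inv_mul (hasDerivAt_one_add_gram a b t)
      (hasDerivAt_gramVariation a b t) (isUnit_iff_ne_zero.2 hp.ne')) |>.congr_deriv ?_
  have hinv : (Matrix.diagonal d)⁻¹ = Matrix.diagonal fun i => (d i)⁻¹ := by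
    refine Matrix.inv_eq_right_inv ?_
    rw [Matrix.diagonal_mul_diagonal, ← Matrix.diagonal_one]
    congr 1
    ext i
    rw [hd, Matrix.det_diagonal] at hp
    exact mul_inv_cancel₀ (Finset.prod_ne_zero_iff.1 hp.ne' i (Finset.mem_univ i))
  rw [hd, hinv]
  have e1 : ∀ N : Matrix ι ι ℝ, ((Matrix.diagonal fun i => (d i)⁻¹) * N).trace =
      ∑ i, N i i / d i := fun N => by
    simp [Matrix.trace, Matrix.diagonal_mul, div_eq_inv_mul]
  have e2 : ∀ N : Matrix ι ι ℝ, ((Matrix.diagonal fun i => (d i)⁻¹) * N *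
      (Matrix.diagonal fun i => (d i)⁻¹) * N).trace =
      ∑ i, ∑ j, N i j * N j i / (d i * d j) := fun N => by
    simp only [Matrix.trace, Matrix.diag_apply]
    refine Finset.sum_congr rfl fun i _ => ?_
    rw [Matrix.mul_apply]
    refine Finset.sum_congr rfl fun j _ => ?_
    rw [Matrix.mul_diagonal, Matrix.diagonal_mul]
    field_simp
  rw [e1, e1, e2]
  have e3 : ∑ i, (Matrix.of fun i j => 2 * inner ℝ (b i) (b j)) i i / d i =
      2 * ∑ i, ‖b i‖ ^ 2 / d i := by
    rw [Finset.mul_sum]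
    refine Finset.sum_congr rfl fun i _ => ?_
    simp; ring
  rw [e3]
  ring

end GramDensity

/-! ### Positivity of the second variation in terms of singular values. -/

section SecondVariation

variable {ι : Type*} [Fintype ι]

/-- The quadratic form `(∑ λ_i x_i)² + ∑ (1 - λ_i²) x_i²`. -/
def diagonalForm (l x : ι → ℝ) : ℝ := (∑ i, l i * x i) ^ 2 + ∑ i, (1 - l i ^ 2) * x i ^ 2

lemma diagonalForm_nonneg_of_le_one {l : ι → ℝ} (hl : ∀ i, 0 ≤ l i) (hl1 : ∀ i, l i ≤ 1)
    (x : ι → ℝ) : 0 ≤ diagonalForm l x := by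
  refine add_nonneg (sq_nonneg _) (Finset.sum_nonneg fun i _ => mul_nonneg ?_ (sq_nonneg _))
  nlinarith [hl i, hl1 i]

lemma eq_zero_of_diagonalForm_eq_zero_of_le_one {l : ι → ℝ} (hl : ∀ i, 0 ≤ l i)
    (hl1 : ∀ i, l i ≤ 1) {x : ι → ℝ} (h : diagonalForm l x = 0) (i : ι) (hi : l i < 1) :
    x i = 0 := by
  have h1 : ∀ i ∈ Finset.univ, 0 ≤ (1 - l i ^ 2) * x i ^ 2 := fun i _ =>
    mul_nonneg (by nlinarith [hl i, hl1 i]) (sq_nonneg _)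
  have h2 : ∑ i, (1 - l i ^ 2) * x i ^ 2 = 0 := by
    have := Finset.sum_nonneg h1
    unfold diagonalForm at h
    nlinarith [sq_nonneg (∑ i, l i * x i)]
  have h3 := (Finset.sum_eq_zero_iff_of_nonneg h1).1 h2 i (Finset.mem_univ i)
  have h4 : (1 - l i ^ 2) ≠ 0 := by nlinarith [hl i]
  simpa [h4] using h3

variable [DecidableEq ι]

/-- Let S = ∑_{j≠k} λ_j x_j. Completing the square in x_k leaves (1 - λ_k²)S², whose coefficient is
nonpositive, so Cauchy-Schwarz bounds it below. The remaining coefficients use λ_j² ≤ ∑_{i≠k} λ_i².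
-/
lemma diagonalForm_ge {l : ι → ℝ} {k : ι} (hk : 1 ≤ l k) (x : ι → ℝ) :
    (x k + l k * ∑ j ∈ Finset.univ.erase k, l j * x j) ^ 2 +
      (1 - l k ^ 2 * ∑ j ∈ Finset.univ.erase k, l j ^ 2) *
        ∑ j ∈ Finset.univ.erase k, x j ^ 2 ≤ diagonalForm l x := by
  unfold diagonalForm
  rw [← Finset.add_sum_erase _ _ (Finset.mem_univ k),
    ← Finset.add_sum_erase Finset.univ (fun i => (1 - l i ^ 2) * x i ^ 2) (Finset.mem_univ k)]
  have hcs := Finset.sum_mul_sq_le_sq_mul_sq (Finset.univ.erase k) l x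
  have hX : (1 - ∑ j ∈ Finset.univ.erase k, l j ^ 2) * ∑ j ∈ Finset.univ.erase k, x j ^ 2 ≤
      ∑ j ∈ Finset.univ.erase k, (1 - l j ^ 2) * x j ^ 2 := by
    rw [Finset.mul_sum]
    refine Finset.sum_le_sum fun j hj => mul_le_mul_of_nonneg_right ?_ (sq_nonneg _)
    have := Finset.single_le_sum (f := fun j => l j ^ 2) (fun i _ => sq_nonneg (l i)) hj
    linarith
  set S := ∑ j ∈ Finset.univ.erase k, l j * x j
  set X := ∑ j ∈ Finset.univ.erase k, x j ^ 2
  set s := ∑ j ∈ Finset.univ.erase k, l j ^ 2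
  have h1 : 0 ≤ (l k ^ 2 - 1) * (s * X - S ^ 2) :=
    mul_nonneg (by nlinarith) (by linarith)
  nlinarith

lemma diagonalForm_nonneg {l : ι → ℝ} (hl : ∀ i, 0 ≤ l i)
    (h : ∀ i, l i ^ 2 * ∑ j ∈ Finset.univ.erase i, l j ^ 2 ≤ 1) (x : ι → ℝ) :
    0 ≤ diagonalForm l x := by
  by_cases hk : ∃ k, 1 ≤ l k
  · obtain ⟨k, hk⟩ := hk
    refine le_trans (add_nonneg (sq_nonneg _) (mul_nonneg ?_ ?_)) (diagonalForm_ge hk x)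
    · linarith [h k]
    · exact Finset.sum_nonneg fun i _ => sq_nonneg _
  · push Not at hk
    exact diagonalForm_nonneg_of_le_one hl (fun i => (hk i).le) x

lemma eq_zero_of_diagonalForm_eq_zero {l : ι → ℝ} (hl : ∀ i, 0 ≤ l i)
    (h : ∀ i, l i ^ 2 * ∑ j ∈ Finset.univ.erase i, l j ^ 2 < 1) {x : ι → ℝ}
    (h0 : diagonalForm l x = 0) (i : ι) : x i = 0 := by
  by_cases hk : ∃ k, 1 ≤ l k
  · obtain ⟨k, hk⟩ := hk
    have h1 := diagonalForm_ge hk x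
    have hX : 0 ≤ ∑ j ∈ Finset.univ.erase k, x j ^ 2 := Finset.sum_nonneg fun i _ => sq_nonneg _
    have h2 : ∑ j ∈ Finset.univ.erase k, x j ^ 2 = 0 := by
      have := sq_nonneg (x k + l k * ∑ j ∈ Finset.univ.erase k, l j * x j)
      nlinarith [h k]
    have h3 : ∀ j ∈ Finset.univ.erase k, x j = 0 := fun j hj => by
      simpa using (Finset.sum_eq_zero_iff_of_nonneg fun i _ => sq_nonneg (x i)).1 h2 j hj
    by_cases hik : i = k
    · subst hik
      rw [h2, Finset.sum_eq_zero fun j hj => by rw [h3 j hj, mul_zero], h0] at h1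
      nlinarith [sq_nonneg (x i)]
    · exact h3 i (Finset.mem_erase.2 ⟨hik, Finset.mem_univ i⟩)
  · push Not at hk
    exact eq_zero_of_diagonalForm_eq_zero_of_le_one hl (fun i => (hk i).le) h0 i (hk i)

/-- The second variation of the area density divided by the density, in terms of the singular
values `l` of the map, the components `b i j = ⟨u_i, B v_j⟩` of the variation with respect to the
singular vectors, and `c j = |B v_j|²`. -/
noncomputable def secondVariation (l : ι → ℝ) (b : ι → ι → ℝ) (c : ι → ℝ) : ℝ :=
  (∑ i, (l i * b i i + l i * b i i) / (1 + l i ^ 2)) ^ 2 / 4 -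
    (∑ i, ∑ j, (l i * b i j + l j * b j i) * (l j * b j i + l i * b i j) /
      ((1 + l i ^ 2) * (1 + l j ^ 2))) / 2 + ∑ j, c j / (1 + l j ^ 2)

/-- Separates the variation into its part orthogonal to the left singular vectors, its diagonal
entries and its pairs of off-diagonal entries, each of which can be signed on its own. -/
lemma secondVariation_eq (l : ι → ℝ) (b : ι → ι → ℝ) (c : ι → ℝ) :
    secondVariation l b c = ∑ j, (c j - ∑ i, b i j ^ 2) / (1 + l j ^ 2) +
      diagonalForm l (fun i => b i i / (1 + l i ^ 2)) +
      (∑ i, ∑ j ∈ Finset.univ.erase i, (b i j ^ 2 + b j i ^ 2 - 2 * (l i * l j) * (b i j * b j i)) /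
        ((1 + l i ^ 2) * (1 + l j ^ 2))) / 2 := by
  have hd : ∀ i, 1 + l i ^ 2 ≠ 0 := fun i => by positivity
  have e1 : ∑ i, (l i * b i i + l i * b i i) / (1 + l i ^ 2) =
      2 * ∑ i, l i * (b i i / (1 + l i ^ 2)) := by
    rw [Finset.mul_sum]
    exact Finset.sum_congr rfl fun i _ => by ring
  have e2 : ∑ j, (c j - ∑ i, b i j ^ 2) / (1 + l j ^ 2) =
      ∑ j, c j / (1 + l j ^ 2) -
        (∑ i, ∑ j, (b i j ^ 2 / (1 + l j ^ 2) + b j i ^ 2 / (1 + l i ^ 2))) / 2 := by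
    have h1 : ∑ i, ∑ j, b j i ^ 2 / (1 + l i ^ 2) = ∑ j, (∑ i, b i j ^ 2) / (1 + l j ^ 2) :=
      Finset.sum_congr rfl fun i _ => by rw [Finset.sum_div]
    have h2 : ∑ i, ∑ j, b i j ^ 2 / (1 + l j ^ 2) = ∑ j, (∑ i, b i j ^ 2) / (1 + l j ^ 2) := by
      rw [Finset.sum_comm]
      exact Finset.sum_congr rfl fun i _ => by rw [Finset.sum_div]
    simp only [Finset.sum_add_distrib, sub_div, Finset.sum_sub_distrib]
    rw [h1, h2]
    ring
  have e3 : ∑ i, ∑ j, (b i j ^ 2 + b j i ^ 2 - 2 * (l i * l j) * (b i j * b j i)) /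
        ((1 + l i ^ 2) * (1 + l j ^ 2)) =
      ∑ i, ∑ j, (b i j ^ 2 / (1 + l j ^ 2) + b j i ^ 2 / (1 + l i ^ 2)) -
      ∑ i, ∑ j, (l i * b i j + l j * b j i) * (l j * b j i + l i * b i j) /
      ((1 + l i ^ 2) * (1 + l j ^ 2)) := by
    simp only [← Finset.sum_sub_distrib]
    refine Finset.sum_congr rfl fun i _ => Finset.sum_congr rfl fun j _ => ?_
    have := hd i
    have := hd j
    field_simp
    ring
  -- The terms i = j of the double sum supply the part of `diagonalForm` with coefficients 1 - λ_i².
  have e4 : ∑ i, ∑ j, (b i j ^ 2 + b j i ^ 2 - 2 * (l i * l j) * (b i j * b j i)) /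
        ((1 + l i ^ 2) * (1 + l j ^ 2)) =
      2 * ∑ i, (1 - l i ^ 2) * (b i i / (1 + l i ^ 2)) ^ 2 +
      ∑ i, ∑ j ∈ Finset.univ.erase i,
        (b i j ^ 2 + b j i ^ 2 - 2 * (l i * l j) * (b i j * b j i)) /
        ((1 + l i ^ 2) * (1 + l j ^ 2)) := by
    rw [Finset.mul_sum, ← Finset.sum_add_distrib]
    refine Finset.sum_congr rfl fun i _ => ?_
    rw [← Finset.add_sum_erase _ _ (Finset.mem_univ i)]
    congr 1
    have := hd i
    field_simp
    ring
  unfold secondVariation diagonalForm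
  rw [e1, e2]
  linarith

/-- The expression equals p(x - y)² + (1 - p)(x² + y²). -/
lemma offDiagonal_nonneg {p x y : ℝ} (h0 : 0 ≤ p) (h : p ≤ 1) :
    0 ≤ x ^ 2 + y ^ 2 - 2 * p * (x * y) := by
  nlinarith [mul_nonneg h0 (sq_nonneg (x - y)), sq_nonneg x, sq_nonneg y,
    mul_nonneg (sub_nonneg.2 h) (add_nonneg (sq_nonneg x) (sq_nonneg y))]

lemma offDiagonal_eq_zero {p x y : ℝ} (h0 : 0 ≤ p) (h : p < 1)
    (hxy : x ^ 2 + y ^ 2 - 2 * p * (x * y) = 0) : x = 0 := by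
  have h1 : (1 - p) * (x ^ 2 + y ^ 2) ≤ 0 := by
    nlinarith [mul_nonneg h0 (sq_nonneg (x - y))]
  have h2 : x ^ 2 + y ^ 2 ≤ 0 := by
    by_contra hc
    push Not at hc
    nlinarith [mul_pos (sub_pos.2 h) hc]
  nlinarith [sq_nonneg x, sq_nonneg y]

lemma secondVariation_nonneg {l : ι → ℝ} {b : ι → ι → ℝ} {c : ι → ℝ} (hl : ∀ i, 0 ≤ l i)
    (hc : ∀ j, ∑ i, b i j ^ 2 ≤ c j) (hd : ∀ x, 0 ≤ diagonalForm l x)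
    (ho : ∀ i j, i ≠ j → l i * l j ≤ 1) : 0 ≤ secondVariation l b c := by
  rw [secondVariation_eq]
  refine add_nonneg (add_nonneg (Finset.sum_nonneg fun j _ => div_nonneg (sub_nonneg.2 (hc j))
    (by positivity)) (hd _)) (div_nonneg (Finset.sum_nonneg fun i _ => Finset.sum_nonneg fun j hj =>
      div_nonneg (offDiagonal_nonneg (mul_nonneg (hl i) (hl j)) ?_) (by positivity)) (by norm_num))
  exact ho i j (Finset.ne_of_mem_erase hj).symm

/-- All nonnegative pieces vanish separately. The hypotheses `hd'` and `ho'` cover the borderline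
cases, where a vanishing piece need not by itself kill the entries it contains; once all b i j are
zero, the normal part yields c j = 0. -/
lemma eq_zero_of_secondVariation_eq_zero {l : ι → ℝ} {b : ι → ι → ℝ} {c : ι → ℝ}
    (hl : ∀ i, 0 ≤ l i) (hc : ∀ j, ∑ i, b i j ^ 2 ≤ c j) (hd : ∀ x, 0 ≤ diagonalForm l x)
    (ho : ∀ i j, i ≠ j → l i * l j ≤ 1)
    (hd' : diagonalForm l (fun i => b i i / (1 + l i ^ 2)) = 0 →
      ∀ i, b i i / (1 + l i ^ 2) = 0)
    (ho' : ∀ i j, i ≠ j → l i * l j = 1 → b i j = 0)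
    (h : secondVariation l b c = 0) (j : ι) : c j = 0 := by
  rw [secondVariation_eq] at h
  have n1 : ∀ j ∈ Finset.univ, 0 ≤ (c j - ∑ i, b i j ^ 2) / (1 + l j ^ 2) := fun j _ =>
    div_nonneg (sub_nonneg.2 (hc j)) (by positivity)
  have n2 := hd fun i => b i i / (1 + l i ^ 2)
  have n3 : ∀ i, ∀ j ∈ Finset.univ.erase i,
      0 ≤ (b i j ^ 2 + b j i ^ 2 - 2 * (l i * l j) * (b i j * b j i)) /
        ((1 + l i ^ 2) * (1 + l j ^ 2)) := fun i j hj =>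
    div_nonneg (offDiagonal_nonneg (mul_nonneg (hl i) (hl j))
      (ho i j (Finset.ne_of_mem_erase hj).symm)) (by positivity)
  have n3' : ∀ i ∈ Finset.univ, _ := fun i _ => Finset.sum_nonneg (n3 i)
  have s1 := Finset.sum_nonneg n1
  have s3 := Finset.sum_nonneg n3'
  have z1 := (Finset.sum_eq_zero_iff_of_nonneg n1).1 (by linarith) j (Finset.mem_univ j)
  have z2 := hd' (by linarith)
  have z3 : ∀ i j, i ≠ j → b i j = 0 := fun i j hij => by
    rcases (ho i j hij).lt_or_eq with hlt | heq
    · have := (Finset.sum_eq_zero_iff_of_nonneg (n3 i)).1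
        ((Finset.sum_eq_zero_iff_of_nonneg n3').1 (by linarith) i (Finset.mem_univ i)) j
          (Finset.mem_erase.2 ⟨hij.symm, Finset.mem_univ j⟩)
      rw [div_eq_zero_iff] at this
      exact offDiagonal_eq_zero (mul_nonneg (hl i) (hl j)) hlt
        (this.resolve_right (by positivity))
    · exact ho' i j hij heq
  have z4 : ∀ i, b i j = 0 := fun i => by
    by_cases hij : i = j
    · subst hij
      have := z2 i
      rw [div_eq_zero_iff] at this
      exact this.resolve_right (by positivity)
    · exact z3 i j hij
  rw [div_eq_zero_iff] at z1
  have := z1.resolve_right (by positivity)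
  simpa [z4] using this

end SecondVariation

/-! ### Singular bases and independence of the orthonormal basis. -/

section LinearMaps

variable {ι κ : Type*} [Fintype ι] [DecidableEq ι] [Fintype κ] [DecidableEq κ]
  {E : Type*} [NormedAddCommGroup E] [InnerProductSpace ℝ E] [FiniteDimensional ℝ E]
  {W : Type*} [NormedAddCommGroup W] [InnerProductSpace ℝ W] [FiniteDimensional ℝ W]

lemma det_one_add_gram_comp (A : E →ₗ[ℝ] W) (v : OrthonormalBasis ι ℝ E) :
    (1 + Matrix.gram ℝ (fun i => A (v i))).det = LinearMap.det (1 + A.adjoint ∘ₗ A) := by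
  rw [← LinearMap.det_toMatrix v.toBasis]
  congr 1
  ext i j
  rw [LinearMap.toMatrix_apply]
  simp only [OrthonormalBasis.coe_toBasis, OrthonormalBasis.coe_toBasis_repr_apply,
    OrthonormalBasis.repr_apply_apply, LinearMap.add_apply, inner_add_right, LinearMap.comp_apply,
    LinearMap.adjoint_inner_right, Matrix.add_apply, Matrix.gram_apply, Module.End.one_apply,
    OrthonormalBasis.inner_eq_ite, Matrix.one_apply]

/-- Both sides are √det(1 + A*A). Bases can therefore be changed at will: singular vectors for
computation, a continuous frame for regularity, an arbitrary one under the integral. -/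
lemma gramDensity_comp_eq (A : E →ₗ[ℝ] W) (v : OrthonormalBasis ι ℝ E)
    (v' : OrthonormalBasis κ ℝ E) :
    gramDensity (fun i => A (v i)) = gramDensity (fun i => A (v' i)) := by
  unfold gramDensity
  rw [det_one_add_gram_comp, det_one_add_gram_comp]

lemma gramDensity_line_comp_eq (A B : E →ₗ[ℝ] W) (v : OrthonormalBasis ι ℝ E)
    (v' : OrthonormalBasis κ ℝ E) (t : ℝ) :
    gramDensity ((fun i => A (v i)) + t • fun i => B (v i)) =
      gramDensity ((fun i => A (v' i)) + t • fun i => B (v' i)) := by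
  simpa [Pi.add_def, Pi.smul_def] using gramDensity_comp_eq (A + t • B) v v'

lemma fderiv_gramDensity_line_comp_eq (A B : E →ₗ[ℝ] W) (v : OrthonormalBasis ι ℝ E)
    (v' : OrthonormalBasis κ ℝ E) (t : ℝ) :
    fderiv ℝ gramDensity ((fun i => A (v i)) + t • fun i => B (v i)) (fun i => B (v i)) =
      fderiv ℝ gramDensity ((fun i => A (v' i)) + t • fun i => B (v' i)) (fun i => B (v' i)) := by
  have h := hasDerivAt_gramDensity_line' (fun i => A (v i)) (fun i => B (v i)) t
  simp only [gramDensity_line_comp_eq A B v v'] at h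
  exact h.unique (hasDerivAt_gramDensity_line' _ _ t)

lemma fderiv_gramDensity_comp_eq (A B : E →ₗ[ℝ] W) (v : OrthonormalBasis ι ℝ E)
    (v' : OrthonormalBasis κ ℝ E) :
    fderiv ℝ gramDensity (fun i => A (v i)) (fun i => B (v i)) =
      fderiv ℝ gramDensity (fun i => A (v' i)) (fun i => B (v' i)) := by
  simpa using fderiv_gramDensity_line_comp_eq A B v v' 0

/-- `v` is an orthonormal basis of right singular vectors of `A`, with singular values `l`. -/
structure IsSingularBasis (A : E →ₗ[ℝ] W) (v : OrthonormalBasis ι ℝ E) (l : ι → ℝ) : Prop where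
  nonneg : ∀ i, 0 ≤ l i
  inner_eq : ∀ i j, inner ℝ (A (v i)) (A (v j)) = if i = j then l i ^ 2 else 0

lemma exists_isSingularBasis {m : ℕ} (hm : Module.finrank ℝ E = m) (A : E →ₗ[ℝ] W) :
    ∃ v : OrthonormalBasis (Fin m) ℝ E, IsSingularBasis A v fun i => A.singularValues i := by
  refine ⟨A.isSymmetric_adjoint_comp_self.eigenvectorBasis hm,
    fun i => A.singularValues_nonneg i, fun i j => ?_⟩
  rw [← LinearMap.adjoint_inner_left, ← LinearMap.comp_apply,
    A.isSymmetric_adjoint_comp_self.apply_eigenvectorBasis, A.sq_singularValues_fin hm]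
  simp [inner_smul_left, OrthonormalBasis.inner_eq_ite]

namespace IsSingularBasis

variable {A : E →ₗ[ℝ] W} {v : OrthonormalBasis ι ℝ E} {l : ι → ℝ}

omit [FiniteDimensional ℝ E] [FiniteDimensional ℝ W] in
lemma norm_sq_apply (h : IsSingularBasis A v l) (i : ι) : ‖A (v i)‖ ^ 2 = l i ^ 2 := by
  rw [← real_inner_self_eq_norm_sq, h.inner_eq, if_pos rfl]

omit [FiniteDimensional ℝ E] [FiniteDimensional ℝ W] in
lemma norm_apply (h : IsSingularBasis A v l) (i : ι) : ‖A (v i)‖ = l i :=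
  (pow_left_inj₀ (norm_nonneg _) (h.nonneg i) two_ne_zero).1 (h.norm_sq_apply i)

omit [FiniteDimensional ℝ E] [FiniteDimensional ℝ W] in
-- The left singular vectors are A v_i / λ_i, with value 0 when λ_i = 0. They need not be completed
-- to an orthonormal system of W, since only Bessel's inequality is used.
lemma exists_left (h : IsSingularBasis A v l) : ∃ u : ι → W, (∀ i, A (v i) = l i • u i) ∧
    (∀ i, ‖u i‖ ≤ 1) ∧ (∀ i, inner ℝ (u i) (A (v i)) = l i) ∧
    ∀ x : W, ∑ i, inner ℝ (u i) x ^ 2 ≤ ‖x‖ ^ 2 := by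
  have h0 : ∀ i, l i = 0 → A (v i) = 0 := fun i hi => by
    rw [← norm_eq_zero, h.norm_apply, hi]
  have h1 : ∀ i, ‖(l i)⁻¹ • A (v i)‖ ≤ 1 := fun i => by
    rw [norm_smul, h.norm_apply, norm_inv, Real.norm_eq_abs, abs_of_nonneg (h.nonneg i)]
    exact inv_mul_le_one
  refine ⟨fun i => (l i)⁻¹ • A (v i), fun i => ?_, h1, fun i => ?_, fun x => ?_⟩
  · by_cases hi : l i = 0
    · simp [h0 i hi]
    · rw [smul_inv_smul₀ hi]
  · rw [inner_smul_left, h.inner_eq, if_pos rfl]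
    by_cases hi : l i = 0
    · simp [hi]
    · simp; field_simp
  -- Bessel's inequality: for z = ∑ ⟨u_i, x⟩u_i one has ⟨z, x⟩ = ∑ ⟨u_i, x⟩² ≥ ‖z‖², and ‖z - x‖² ≥
  -- 0 concludes.
  · set u : ι → W := fun i => (l i)⁻¹ • A (v i)
    have horth : ∀ i j, i ≠ j → inner ℝ (u i) (u j) = 0 := fun i j hij => by
      simp [u, inner_smul_left, inner_smul_right, h.inner_eq, hij]
    have hz : ∀ i, inner ℝ (u i) (∑ j, inner ℝ (u j) x • u j) =
        inner ℝ (u i) x * ‖u i‖ ^ 2 := fun i => by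
      rw [inner_sum, Finset.sum_eq_single i]
      · rw [inner_smul_right, real_inner_self_eq_norm_sq]
      · intro j _ hj
        rw [inner_smul_right, horth i j hj.symm, mul_zero]
      · simp
    have h3 : inner ℝ (∑ i, inner ℝ (u i) x • u i) x = ∑ i, inner ℝ (u i) x ^ 2 := by
      rw [sum_inner]
      exact Finset.sum_congr rfl fun i _ => by rw [inner_smul_left]; simp; ring
    have h4 : ‖∑ i, inner ℝ (u i) x • u i‖ ^ 2 ≤ ∑ i, inner ℝ (u i) x ^ 2 := by
      rw [← real_inner_self_eq_norm_sq, sum_inner]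
      refine Finset.sum_le_sum fun i _ => ?_
      rw [inner_smul_left, hz]
      have : ‖u i‖ ^ 2 ≤ 1 := pow_le_one₀ (norm_nonneg _) (h1 i)
      simp only [conj_trivial]
      nlinarith [sq_nonneg (inner ℝ (u i) x)]
    have h5 := norm_sub_sq_real (∑ i, inner ℝ (u i) x • u i) x
    rw [h3] at h5
    nlinarith [sq_nonneg ‖(∑ i, inner ℝ (u i) x • u i) - x‖]

omit [FiniteDimensional ℝ E] [FiniteDimensional ℝ W] in
lemma norm_apply_le (h : IsSingularBasis A v l) {r : ℝ} (hr : ∀ i, l i ≤ r) (hr0 : 0 ≤ r) (x : E) :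
    ‖A x‖ ≤ r * ‖x‖ := by
  refine abs_le_of_sq_le_sq' ?_ (by positivity) |>.2
  have hx : A x = ∑ i, inner ℝ (v i) x • A (v i) := by
    conv_lhs => rw [← v.sum_repr' x]
    simp
  have h1 : ‖A x‖ ^ 2 = ∑ i, inner ℝ (v i) x ^ 2 * l i ^ 2 := by
    rw [← real_inner_self_eq_norm_sq, hx, sum_inner]
    refine Finset.sum_congr rfl fun i _ => ?_
    rw [inner_sum, Finset.sum_eq_single i]
    · rw [inner_smul_left, inner_smul_right, h.inner_eq, if_pos rfl]; simp; ring
    · intro j _ hj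
      rw [inner_smul_left, inner_smul_right, h.inner_eq, if_neg hj.symm]; simp
    · simp
  rw [h1, mul_pow, ← v.sum_sq_inner_right x, Finset.mul_sum]
  refine Finset.sum_le_sum fun i _ => ?_
  have := pow_le_pow_left₀ (h.nonneg i) (hr i) 2
  rw [mul_comm]
  exact mul_le_mul_of_nonneg_right this (sq_nonneg _)

omit [FiniteDimensional ℝ E] [FiniteDimensional ℝ W] in
/-- The second derivative of the area density along a line of linear maps, in singular
vectors. -/
lemma exists_hasDerivAt {A B : E →ₗ[ℝ] W} {t : ℝ} (h : IsSingularBasis (A + t • B) v l) :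
    ∃ b : ι → ι → ℝ, (∀ j, ∑ i, b i j ^ 2 ≤ ‖B (v j)‖ ^ 2) ∧
      HasDerivAt (fun s : ℝ => fderiv ℝ gramDensity ((fun i => A (v i)) + s • fun i => B (v i))
        (fun i => B (v i)))
        (gramDensity ((fun i => A (v i)) + t • fun i => B (v i)) *
          secondVariation l b fun j => ‖B (v j)‖ ^ 2) t := by
  obtain ⟨u, hu1, -, -, hu4⟩ := h.exists_left
  refine ⟨fun i j => inner ℝ (u i) (B (v j)), fun j => hu4 _, ?_⟩
  have hd : 1 + Matrix.gram ℝ ((fun i => A (v i)) + t • fun i => B (v i)) =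
      Matrix.diagonal fun i => 1 + l i ^ 2 := by
    ext i j
    have := h.inner_eq i j
    simp only [LinearMap.add_apply, LinearMap.smul_apply] at this
    simp only [Matrix.add_apply, Matrix.gram_apply, Pi.add_apply, Pi.smul_apply, this,
      Matrix.one_apply, Matrix.diagonal_apply]
    split_ifs <;> simp
  refine (hasDerivAt_fderiv_gramDensity_line _ _ t hd).congr_deriv ?_
  have hg : ∀ i j, gramVariation (fun i => A (v i)) (fun i => B (v i)) t i j =
      l i * inner ℝ (u i) (B (v j)) + l j * inner ℝ (u j) (B (v i)) := fun i j => by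
    have e : ∀ i, A (v i) + t • B (v i) = l i • u i := fun i => hu1 i
    simp only [gramVariation, Matrix.of_apply, e, inner_smul_left, inner_smul_right]
    rw [real_inner_comm (B (v i))]
    simp
  simp only [hg, secondVariation]

end IsSingularBasis

omit [DecidableEq ι] in
lemma sum_norm_sq_apply_eq_trace (A : E →ₗ[ℝ] W) (v : OrthonormalBasis ι ℝ E) :
    ∑ i, ‖A (v i)‖ ^ 2 = LinearMap.trace ℝ E (A.adjoint ∘ₗ A) := by
  rw [LinearMap.trace_eq_sum_inner _ v]
  refine Finset.sum_congr rfl fun i _ => ?_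
  rw [LinearMap.comp_apply, LinearMap.adjoint_inner_right, real_inner_self_eq_norm_sq]

omit [DecidableEq ι] in
omit [FiniteDimensional ℝ E] [FiniteDimensional ℝ W] in
-- Duality between nuclear and operator norm, from expanding A in its own singular vectors. It makes
-- the sum of singular values a supremum of linear functions of A, hence convex.
lemma sum_inner_apply_le {A : E →ₗ[ℝ] W} {p : OrthonormalBasis κ ℝ E} {l : κ → ℝ}
    (h : IsSingularBasis A p l) (v : OrthonormalBasis ι ℝ E) (u : ι → W)
    (hu : ∀ x : W, ∑ i, inner ℝ (u i) x ^ 2 ≤ ‖x‖ ^ 2) :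
    ∑ i, inner ℝ (u i) (A (v i)) ≤ ∑ k, l k := by
  obtain ⟨q, hq1, hq2, -, -⟩ := h.exists_left
  have hv : ∀ i, inner ℝ (u i) (A (v i)) =
      ∑ k, l k * (inner ℝ (v i) (p k) * inner ℝ (u i) (q k)) := fun i => by
    conv_lhs => rw [← p.sum_repr' (v i)]
    simp only [map_sum, map_smul, inner_sum, inner_smul_right, hq1]
    refine Finset.sum_congr rfl fun k _ => ?_
    rw [real_inner_comm (v i)]
    ring
  simp only [hv]
  rw [Finset.sum_comm]
  refine Finset.sum_le_sum fun k _ => ?_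
  rw [← Finset.mul_sum]
  refine mul_le_of_le_one_right (h.nonneg k) ?_
  have h1 : ∑ i, inner ℝ (v i) (p k) ^ 2 = 1 := by
    rw [v.sum_sq_inner_right]; simp
  have h2 : ∑ i, inner ℝ (u i) (q k) ^ 2 ≤ 1 :=
    (hu (q k)).trans (pow_le_one₀ (norm_nonneg _) (hq2 k))
  have h3 : ∑ i, inner ℝ (v i) (p k) * inner ℝ (u i) (q k) ≤
      ∑ i, (inner ℝ (v i) (p k) ^ 2 + inner ℝ (u i) (q k) ^ 2) / 2 :=
    Finset.sum_le_sum fun i _ => by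
      nlinarith [sq_nonneg (inner ℝ (v i) (p k) - inner ℝ (u i) (q k))]
  rw [← Finset.sum_div, Finset.sum_add_distrib] at h3
  linarith

end LinearMaps

/-! ### Strict monotonicity of the differential of the area density. -/

section Monotonicity

lemma le_and_deriv_eq_zero_of_deriv_nonneg {f : ℝ → ℝ} (hf : Differentiable ℝ f)
    (h : ∀ t ∈ Ioo (0 : ℝ) 1, 0 ≤ deriv f t) :
    f 0 ≤ f 1 ∧ (f 0 = f 1 → ∀ t ∈ Ioo (0 : ℝ) 1, deriv f t = 0) := by
  have hm : MonotoneOn f (Icc 0 1) := monotoneOn_of_deriv_nonneg (convex_Icc 0 1)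
    hf.continuous.continuousOn hf.differentiableOn (by simpa using h)
  have h0 : (0 : ℝ) ∈ Icc (0 : ℝ) 1 := by simp
  have h1 : (1 : ℝ) ∈ Icc (0 : ℝ) 1 := by simp
  refine ⟨hm h0 h1 zero_le_one, fun he t ht => ?_⟩
  have hc : f =ᶠ[𝓝 t] fun _ => f 0 := by
    filter_upwards [Ioo_mem_nhds ht.1 ht.2] with s hs
    have hs' := Ioo_subset_Icc_self hs
    exact le_antisymm ((hm hs' h1 hs'.2).trans he.ge) (hm h0 hs' hs'.1)
  rw [hc.deriv_eq, deriv_const]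

variable {E : Type*} [NormedAddCommGroup E] [InnerProductSpace ℝ E] [FiniteDimensional ℝ E]
  {W : Type*} [NormedAddCommGroup W] [InnerProductSpace ℝ W] [FiniteDimensional ℝ W]

omit [FiniteDimensional ℝ E] [FiniteDimensional ℝ W] in
-- The deficit t(1 - t)‖(A₁ - A₀)x‖² is the strict convexity behind all rigidity statements below.
lemma norm_sq_line_apply (A₀ A₁ : E →ₗ[ℝ] W) (t : ℝ) (x : E) :
    ‖(A₀ + t • (A₁ - A₀)) x‖ ^ 2 = (1 - t) * ‖A₀ x‖ ^ 2 + t * ‖A₁ x‖ ^ 2 -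
      t * (1 - t) * ‖(A₁ - A₀) x‖ ^ 2 := by
  simp only [← real_inner_self_eq_norm_sq, LinearMap.add_apply, LinearMap.smul_apply,
    LinearMap.sub_apply, inner_add_left, inner_add_right, inner_sub_left, inner_sub_right,
    inner_smul_left, inner_smul_right, conj_trivial]
  rw [real_inner_comm (A₀ x) (A₁ x)]
  ring

variable {m : ℕ}

/-- Criterion for the monotonicity of the differential of the area density along a segment. -/
lemma fderiv_gramDensity_mono_of_secondVariation (hm : Module.finrank ℝ E = m)
    (w : OrthonormalBasis (Fin m) ℝ E) (A₀ A₁ : E →ₗ[ℝ] W) (R : ℝ → Prop)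
    (hR : (∀ t ∈ Ioo (0 : ℝ) 1, R t) → A₀ = A₁)
    (h : ∀ t ∈ Ioo (0 : ℝ) 1, ∀ v : OrthonormalBasis (Fin m) ℝ E,
      IsSingularBasis (A₀ + t • (A₁ - A₀)) v
        (fun i => (A₀ + t • (A₁ - A₀)).singularValues i) → ∀ b : Fin m → Fin m → ℝ,
      (∀ j, ∑ i, b i j ^ 2 ≤ ‖(A₁ - A₀) (v j)‖ ^ 2) →
      0 ≤ secondVariation (fun i : Fin m => (A₀ + t • (A₁ - A₀)).singularValues i) b
          (fun j => ‖(A₁ - A₀) (v j)‖ ^ 2) ∧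
        (secondVariation (fun i : Fin m => (A₀ + t • (A₁ - A₀)).singularValues i) b
          (fun j => ‖(A₁ - A₀) (v j)‖ ^ 2) = 0 → (∀ j, ‖(A₁ - A₀) (v j)‖ ^ 2 = 0) ∨ R t)) :
    0 ≤ fderiv ℝ gramDensity (fun i => A₁ (w i)) (fun i => (A₁ - A₀) (w i)) -
        fderiv ℝ gramDensity (fun i => A₀ (w i)) (fun i => (A₁ - A₀) (w i)) ∧
      (fderiv ℝ gramDensity (fun i => A₁ (w i)) (fun i => (A₁ - A₀) (w i)) -
        fderiv ℝ gramDensity (fun i => A₀ (w i)) (fun i => (A₁ - A₀) (w i)) = 0 → A₀ = A₁) := by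
  set B := A₁ - A₀ with hB
  set f : ℝ → ℝ := fun s => fderiv ℝ gramDensity ((fun i => A₀ (w i)) + s • fun i => B (w i))
    (fun i => B (w i)) with hf
  have hder : ∀ t, ∃ v : OrthonormalBasis (Fin m) ℝ E, ∃ b : Fin m → Fin m → ℝ, ∃ c : ℝ, 0 < c ∧
      IsSingularBasis (A₀ + t • B) v (fun i => (A₀ + t • B).singularValues i) ∧
      (∀ j, ∑ i, b i j ^ 2 ≤ ‖B (v j)‖ ^ 2) ∧
      HasDerivAt f (c * secondVariation (fun i : Fin m => (A₀ + t • B).singularValues i) b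
          (fun j => ‖B (v j)‖ ^ 2)) t := fun t => by
    -- The singular basis varies with t, so the derivative computed in it is carried back to the
    -- fixed basis `w` by basis independence.
    obtain ⟨v, hv⟩ := exists_isSingularBasis hm (A₀ + t • B)
    obtain ⟨b, hb, hd⟩ := hv.exists_hasDerivAt
    simp only [fderiv_gramDensity_line_comp_eq A₀ B v w] at hd
    exact ⟨v, b, _, gramDensity_pos _, hv, hb, hd⟩
  have hdiff : Differentiable ℝ f := fun t => by
    obtain ⟨v, b, c, -, -, -, hd⟩ := hder t
    exact hd.differentiableAt
  have hfn : ∀ t ∈ Ioo (0 : ℝ) 1, 0 ≤ deriv f t := fun t ht => by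
    obtain ⟨v, b, c, hc, hv, hb, hd⟩ := hder t
    rw [hd.deriv]
    exact mul_nonneg hc.le (h t ht v hv b hb).1
  obtain ⟨hle, heq⟩ := le_and_deriv_eq_zero_of_deriv_nonneg hdiff hfn
  have hf0 : f 0 = fderiv ℝ gramDensity (fun i => A₀ (w i)) (fun i => B (w i)) := by
    simp [hf]
  have hf1 : f 1 = fderiv ℝ gramDensity (fun i => A₁ (w i)) (fun i => B (w i)) := by
    simp only [hf]
    congr 2
    ext1 i
    simp [hB]
  rw [hf0, hf1] at hle heq
  refine ⟨sub_nonneg.2 hle, fun h0 => ?_⟩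
  have hz := heq (sub_eq_zero.1 h0).symm
  -- If A₀ ≠ A₁, then B cannot vanish on a basis, so the alternative `R t` holds for every t, which
  -- `hR` excludes.
  by_contra hne
  refine hne (hR fun t ht => ?_)
  obtain ⟨v, b, c, hc, hv, hb, hd⟩ := hder t
  have := hz t ht
  rw [hd.deriv, mul_eq_zero] at this
  refine ((h t ht v hv b hb).2 (this.resolve_left hc.ne')).resolve_left fun hB0 => hne ?_
  have : B = 0 := v.toBasis.ext fun i => by simpa using hB0 i
  rw [hB, sub_eq_zero] at this
  exact this.symm

omit [FiniteDimensional ℝ E] [FiniteDimensional ℝ W] in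
-- The sum is a quadratic polynomial in t with leading coefficient ∑ ‖(A₁ - A₀)w_i‖². Its second
-- difference over three equally spaced points vanishes.
lemma eq_of_sum_norm_sq_line_eq (w : OrthonormalBasis (Fin m) ℝ E) (A₀ A₁ : E →ₗ[ℝ] W) (r : ℝ)
    (h : ∀ t ∈ Ioo (0 : ℝ) 1, ∑ i, ‖(A₀ + t • (A₁ - A₀)) (w i)‖ ^ 2 = r) : A₀ = A₁ := by
  simp only [norm_sq_line_apply, Finset.sum_sub_distrib, Finset.sum_add_distrib,
    ← Finset.mul_sum] at h
  have h1 := h (1 / 4) (by norm_num)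
  have h2 := h (1 / 2) (by norm_num)
  have h3 := h (3 / 4) (by norm_num)
  have h4 : ∑ i, ‖(A₁ - A₀) (w i)‖ ^ 2 = 0 := by linarith
  rw [Finset.sum_eq_zero_iff_of_nonneg fun i _ => sq_nonneg _] at h4
  have : A₁ - A₀ = 0 := w.toBasis.ext fun i => by simpa using h4 i (Finset.mem_univ i)
  exact (sub_eq_zero.1 this).symm

/-- Monotonicity for length non-increasing maps. -/
lemma fderiv_gramDensity_mono_of_le_one (hm : Module.finrank ℝ E = m)
    (w : OrthonormalBasis (Fin m) ℝ E) (A₀ A₁ : E →ₗ[ℝ] W)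
    (h₀ : ∀ i : Fin m, A₀.singularValues i ≤ 1) (h₁ : ∀ i : Fin m, A₁.singularValues i ≤ 1) :
    0 ≤ fderiv ℝ gramDensity (fun i => A₁ (w i)) (fun i => (A₁ - A₀) (w i)) -
        fderiv ℝ gramDensity (fun i => A₀ (w i)) (fun i => (A₁ - A₀) (w i)) ∧
      (fderiv ℝ gramDensity (fun i => A₁ (w i)) (fun i => (A₁ - A₀) (w i)) -
        fderiv ℝ gramDensity (fun i => A₀ (w i)) (fun i => (A₁ - A₀) (w i)) = 0 → A₀ = A₁) := by
  -- The exceptional alternative never occurs in this case, so `R` may be the desired conclusion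
  -- itself.
  refine fderiv_gramDensity_mono_of_secondVariation hm w A₀ A₁ (fun _ => A₀ = A₁)
    (fun h => h (1 / 2) (by norm_num)) fun t ht v hv b hb => ?_
  obtain ⟨v₀, hv₀⟩ := exists_isSingularBasis hm A₀
  obtain ⟨v₁, hv₁⟩ := exists_isSingularBasis hm A₁
  -- By strict convexity, a singular value equal to 1 inside the segment forces A₁ - A₀ to vanish on
  -- its singular vector, which settles the borderline entries.
  have hbd : ∀ i : Fin m, (A₀ + t • (A₁ - A₀)).singularValues i ^ 2 ≤
      1 - t * (1 - t) * ‖(A₁ - A₀) (v i)‖ ^ 2 := fun i => by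
    rw [← hv.norm_sq_apply, norm_sq_line_apply]
    have e0 := hv₀.norm_apply_le h₀ zero_le_one (v i)
    have e1 := hv₁.norm_apply_le h₁ zero_le_one (v i)
    rw [v.norm_eq_one, mul_one] at e0 e1
    have e0' := pow_le_one₀ (norm_nonneg (A₀ (v i))) e0 (n := 2)
    have e1' := pow_le_one₀ (norm_nonneg (A₁ (v i))) e1 (n := 2)
    have t0 := ht.1
    have t1 := sub_pos.2 ht.2
    nlinarith
  have htt : 0 < t * (1 - t) := mul_pos ht.1 (sub_pos.2 ht.2)
  set l : Fin m → ℝ := fun i => (A₀ + t • (A₁ - A₀)).singularValues i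
  have hl0 : ∀ i, 0 ≤ l i := hv.nonneg
  have hl1 : ∀ i, l i ≤ 1 := fun i => by
    have : l i ^ 2 ≤ 1 ^ 2 := by
      nlinarith [hbd i, mul_nonneg htt.le (sq_nonneg ‖(A₁ - A₀) (v i)‖)]
    exact le_of_sq_le_sq this zero_le_one
  have hb0 : ∀ i j, l j = 1 → b i j = 0 := fun i j hj => by
    have h1 := hbd j
    change l j ^ 2 ≤ _ at h1
    rw [hj] at h1
    have h2 : ‖(A₁ - A₀) (v j)‖ ^ 2 ≤ 0 := by
      by_contra hc
      push Not at hc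
      nlinarith [mul_pos htt hc]
    have h3 := Finset.single_le_sum (f := fun i => b i j ^ 2) (fun i _ => sq_nonneg _)
      (Finset.mem_univ i)
    have h4 : b i j ^ 2 ≤ 0 := h3.trans ((hb j).trans h2)
    nlinarith
  have ho : ∀ i j, i ≠ j → l i * l j ≤ 1 := fun i j _ => mul_le_one₀ (hl1 i) (hl0 j) (hl1 j)
  have hd := diagonalForm_nonneg_of_le_one hl0 hl1
  refine ⟨secondVariation_nonneg hl0 hb hd ho, fun hz => Or.inl ?_⟩
  refine eq_zero_of_secondVariation_eq_zero hl0 hb hd ho (fun h0 i => ?_) (fun i j _ hij => ?_) hz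
  · rcases (hl1 i).lt_or_eq with hlt | heq
    · exact eq_zero_of_diagonalForm_eq_zero_of_le_one hl0 hl1 h0 i hlt
    · rw [hb0 i i heq, zero_div]
  · refine hb0 i j (le_antisymm (hl1 j) ?_)
    nlinarith [hl0 i, hl1 i, hl0 j, hl1 j]

/-- Monotonicity when `λ_i² ∑_{j ≠ i} λ_j² ≤ 1` along the segment, with equality only at maps of
Frobenius norm `√2`. -/
lemma fderiv_gramDensity_mono_of_sq_mul_sum_le (hm : Module.finrank ℝ E = m)
    (w : OrthonormalBasis (Fin m) ℝ E) (A₀ A₁ : E →ₗ[ℝ] W)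
    (h : ∀ t ∈ Ioo (0 : ℝ) 1, ∀ v : OrthonormalBasis (Fin m) ℝ E, ∀ l : Fin m → ℝ,
      IsSingularBasis (A₀ + t • (A₁ - A₀)) v l → ∀ i,
        l i ^ 2 * ∑ j ∈ Finset.univ.erase i, l j ^ 2 ≤ 1 ∧
        (l i ^ 2 * ∑ j ∈ Finset.univ.erase i, l j ^ 2 = 1 → ∑ j, l j ^ 2 = 2)) :
    0 ≤ fderiv ℝ gramDensity (fun i => A₁ (w i)) (fun i => (A₁ - A₀) (w i)) -
        fderiv ℝ gramDensity (fun i => A₀ (w i)) (fun i => (A₁ - A₀) (w i)) ∧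
      (fderiv ℝ gramDensity (fun i => A₁ (w i)) (fun i => (A₁ - A₀) (w i)) -
        fderiv ℝ gramDensity (fun i => A₀ (w i)) (fun i => (A₁ - A₀) (w i)) = 0 → A₀ = A₁) := by
  refine fderiv_gramDensity_mono_of_secondVariation hm w A₀ A₁
    (fun t => ∑ i, ‖(A₀ + t • (A₁ - A₀)) (w i)‖ ^ 2 = 2)
    (eq_of_sum_norm_sq_line_eq w A₀ A₁ 2) fun t ht v hv b hb => ?_
  have hl := h t ht v _ hv
  have hF : ∑ i, ‖(A₀ + t • (A₁ - A₀)) (w i)‖ ^ 2 =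
      ∑ i : Fin m, (A₀ + t • (A₁ - A₀)).singularValues i ^ 2 := by
    simp only [sum_norm_sq_apply_eq_trace, ← hv.norm_sq_apply]
  rw [hF]
  set l : Fin m → ℝ := fun i => (A₀ + t • (A₁ - A₀)).singularValues i
  have hl0 : ∀ i, 0 ≤ l i := hv.nonneg
  have hsq : ∀ i j, i ≠ j → (l i * l j) ^ 2 ≤ l i ^ 2 * ∑ j ∈ Finset.univ.erase i, l j ^ 2 :=
    fun i j hij => by
      rw [mul_pow]
      exact mul_le_mul_of_nonneg_left (Finset.single_le_sum (f := fun j => l j ^ 2)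
        (fun i _ => sq_nonneg (l i)) (Finset.mem_erase.2 ⟨hij.symm, Finset.mem_univ j⟩))
        (sq_nonneg _)
  have ho : ∀ i j, i ≠ j → l i * l j ≤ 1 := fun i j hij =>
    le_of_sq_le_sq (by linarith [hsq i j hij, (hl i).1]) zero_le_one
  have hd := diagonalForm_nonneg hl0 fun i => (hl i).1
  refine ⟨secondVariation_nonneg hl0 hb hd ho, fun hz => ?_⟩
  by_cases hs : ∃ i, l i ^ 2 * ∑ j ∈ Finset.univ.erase i, l j ^ 2 = 1
  · obtain ⟨i, hi⟩ := hs
    exact Or.inr ((hl i).2 hi)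
  · push Not at hs
    have hlt : ∀ i, l i ^ 2 * ∑ j ∈ Finset.univ.erase i, l j ^ 2 < 1 := fun i =>
      lt_of_le_of_ne (hl i).1 (hs i)
    refine Or.inl (eq_zero_of_secondVariation_eq_zero hl0 hb hd ho
      (eq_zero_of_diagonalForm_eq_zero hl0 hlt) (fun i j hij h1 => ?_) hz)
    have := hsq i j hij
    rw [h1] at this
    linarith [hlt i]

/-- The inequality of arithmetic and geometric means for λ_i² and the sum of the other squares. -/
lemma sq_mul_sum_le_of_sum_sq_le {l : Fin m → ℝ} (h : ∑ i, l i ^ 2 ≤ 2) (i : Fin m) :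
    l i ^ 2 * ∑ j ∈ Finset.univ.erase i, l j ^ 2 ≤ 1 ∧
      (l i ^ 2 * ∑ j ∈ Finset.univ.erase i, l j ^ 2 = 1 → ∑ j, l j ^ 2 = 2) := by
  rw [← Finset.add_sum_erase _ _ (Finset.mem_univ i)] at h ⊢
  have h0 : 0 ≤ ∑ j ∈ Finset.univ.erase i, l j ^ 2 := Finset.sum_nonneg fun _ _ => sq_nonneg _
  have h1 := sq_nonneg (l i)
  set s := ∑ j ∈ Finset.univ.erase i, l j ^ 2
  set p := l i ^ 2
  exact ⟨by nlinarith [sq_nonneg (p - s)], fun he => by nlinarith [sq_nonneg (p - s)]⟩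

/-- With q = ∑_{j≠i} λ_j, the other squares sum to at most q², and λ_i q ≤ 1 by arithmetic-geometric
means. Equality forces λ_i = q = 1, so the other squares sum to 1. -/
lemma sq_mul_sum_le_of_sum_le {l : Fin m → ℝ} (hl : ∀ i, 0 ≤ l i) (h : ∑ i, l i ≤ 2) (i : Fin m) :
    l i ^ 2 * ∑ j ∈ Finset.univ.erase i, l j ^ 2 ≤ 1 ∧
      (l i ^ 2 * ∑ j ∈ Finset.univ.erase i, l j ^ 2 = 1 → ∑ j, l j ^ 2 = 2) := by
  rw [← Finset.add_sum_erase _ _ (Finset.mem_univ i)] at h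
  rw [← Finset.add_sum_erase Finset.univ (fun j => l j ^ 2) (Finset.mem_univ i)]
  have h0 : ∑ j ∈ Finset.univ.erase i, l j ^ 2 ≤ (∑ j ∈ Finset.univ.erase i, l j) ^ 2 :=
    Finset.sum_sq_le_sq_sum_of_nonneg fun j _ => hl j
  have h1 : 0 ≤ ∑ j ∈ Finset.univ.erase i, l j := Finset.sum_nonneg fun j _ => hl j
  have h2 := hl i
  set s := ∑ j ∈ Finset.univ.erase i, l j ^ 2
  set q := ∑ j ∈ Finset.univ.erase i, l j
  set p := l i
  have h3 : p * q ≤ 1 := by nlinarith [sq_nonneg (p - q)]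
  have h4 : p ^ 2 * s ≤ (p * q) ^ 2 := by
    rw [mul_pow]
    exact mul_le_mul_of_nonneg_left h0 (sq_nonneg p)
  have h5 : (p * q) ^ 2 ≤ 1 := pow_le_one₀ (mul_nonneg h2 h1) h3
  refine ⟨h4.trans h5, fun he => ?_⟩
  have h6 : p * q = 1 := by
    refine le_antisymm h3 ?_
    nlinarith [mul_nonneg h2 h1]
  have h7 : p = q := by nlinarith [sq_nonneg (p - q)]
  have h8 : p = 1 := by rw [← h7] at h6; nlinarith
  rw [h8] at he ⊢
  linarith

/-- The differential of the area density is strictly monotone on each of the four classes of linear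
maps. -/
theorem fderiv_gramDensity_mono (hm : Module.finrank ℝ E = m)
    (w : OrthonormalBasis (Fin m) ℝ E) (A₀ A₁ : E →ₗ[ℝ] W)
    (h : ((∀ i : Fin m, A₀.singularValues i ≤ 1) ∧ ∀ i : Fin m, A₁.singularValues i ≤ 1) ∨
      (∑ i : Fin m, A₀.singularValues i ≤ 2 ∧ ∑ i : Fin m, A₁.singularValues i ≤ 2) ∨
      (∑ i : Fin m, A₀.singularValues i ^ 2 ≤ 2 ∧ ∑ i : Fin m, A₁.singularValues i ^ 2 ≤ 2) ∨
      (∑ i : Fin m, √(1 + A₀.singularValues i ^ 2) ≤ 2 ∧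
        ∑ i : Fin m, √(1 + A₁.singularValues i ^ 2) ≤ 2)) :
    0 ≤ fderiv ℝ gramDensity (fun i => A₁ (w i)) (fun i => (A₁ - A₀) (w i)) -
        fderiv ℝ gramDensity (fun i => A₀ (w i)) (fun i => (A₁ - A₀) (w i)) ∧
      (fderiv ℝ gramDensity (fun i => A₁ (w i)) (fun i => (A₁ - A₀) (w i)) -
        fderiv ℝ gramDensity (fun i => A₀ (w i)) (fun i => (A₁ - A₀) (w i)) = 0 → A₀ = A₁) := by
  obtain ⟨v₀, hv₀⟩ := exists_isSingularBasis hm A₀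
  obtain ⟨v₁, hv₁⟩ := exists_isSingularBasis hm A₁
  rcases h with ⟨e0, e1⟩ | ⟨e0, e1⟩ | ⟨e0, e1⟩ | ⟨e0, e1⟩
  · exact fderiv_gramDensity_mono_of_le_one hm w A₀ A₁ e0 e1
  · refine fderiv_gramDensity_mono_of_sq_mul_sum_le hm w A₀ A₁ fun t ht v l hv =>
      sq_mul_sum_le_of_sum_le hv.nonneg ?_
    -- With the singular vectors of the intermediate map frozen, its nuclear norm is a convex
    -- combination of pairings with A₀ and A₁, each bounded by a nuclear norm.
    obtain ⟨u, -, -, hu3, hu4⟩ := hv.exists_left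
    replace e0 := (sum_inner_apply_le hv₀ v u hu4).trans e0
    replace e1 := (sum_inner_apply_le hv₁ v u hu4).trans e1
    have e2 : ∑ i, l i = (1 - t) * ∑ i, inner ℝ (u i) (A₀ (v i)) +
        t * ∑ i, inner ℝ (u i) (A₁ (v i)) := by
      rw [Finset.mul_sum, Finset.mul_sum, ← Finset.sum_add_distrib]
      refine Finset.sum_congr rfl fun i _ => ?_
      rw [← hu3 i]
      simp only [LinearMap.add_apply, LinearMap.smul_apply, LinearMap.sub_apply, inner_add_right,
        inner_smul_right, inner_sub_right]
      ring
    rw [e2]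
    nlinarith [ht.1, ht.2, mul_le_mul_of_nonneg_left e0 (sub_nonneg.2 ht.2.le),
      mul_le_mul_of_nonneg_left e1 ht.1.le]
  · refine fderiv_gramDensity_mono_of_sq_mul_sum_le hm w A₀ A₁ fun t ht v l hv =>
      sq_mul_sum_le_of_sum_sq_le ?_
    simp only [← hv₀.norm_sq_apply, ← hv₁.norm_sq_apply, sum_norm_sq_apply_eq_trace] at e0 e1
    rw [← sum_norm_sq_apply_eq_trace _ v] at e0 e1
    simp only [← hv.norm_sq_apply, norm_sq_line_apply, Finset.sum_sub_distrib,
      Finset.sum_add_distrib, ← Finset.mul_sum]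
    have e2 : 0 ≤ ∑ i, ‖(A₁ - A₀) (v i)‖ ^ 2 := Finset.sum_nonneg fun _ _ => sq_nonneg _
    nlinarith [mul_le_mul_of_nonneg_left e0 (sub_nonneg.2 ht.2.le),
      mul_le_mul_of_nonneg_left e1 ht.1.le,
      mul_nonneg (mul_nonneg ht.1.le (sub_nonneg.2 ht.2.le)) e2]
  -- For m ≤ 1 there is no other index j and the criterion is trivial. For m ≥ 2 each root is at
  -- least 1, so a sum of at most 2 makes every singular value zero and both maps vanish.
  · rcases Nat.lt_or_ge m 2 with hm2 | hm2
    · refine fderiv_gramDensity_mono_of_sq_mul_sum_le hm w A₀ A₁ fun t ht v l hv i => ?_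
      have : Finset.univ.erase i = ∅ := by
        refine Finset.eq_empty_of_forall_notMem fun j hj => (Finset.ne_of_mem_erase hj) ?_
        exact Fin.ext (by omega)
      simp [this]
    · have key : ∀ A : E →ₗ[ℝ] W, ∑ i : Fin m, √(1 + A.singularValues i ^ 2) ≤ 2 → A = 0 :=
          fun A hA => by
        obtain ⟨v, hv⟩ := exists_isSingularBasis hm A
        have h1 : ∀ i ∈ Finset.univ, 0 ≤ √(1 + A.singularValues (i : Fin m) ^ 2) - 1 :=
          fun i _ => sub_nonneg.2 (Real.one_le_sqrt.2 (by nlinarith [sq_nonneg (A.singularValues i)]))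
        have h2 : ∑ i : Fin m, (√(1 + A.singularValues i ^ 2) - 1) = 0 := by
          refine le_antisymm ?_ (Finset.sum_nonneg h1)
          rw [Finset.sum_sub_distrib]
          have : (2 : ℝ) ≤ m := by exact_mod_cast hm2
          simp only [Finset.sum_const, Finset.card_univ, Fintype.card_fin, nsmul_eq_mul, mul_one]
          linarith
        refine v.toBasis.ext fun i => ?_
        have h3 := (Finset.sum_eq_zero_iff_of_nonneg h1).1 h2 i (Finset.mem_univ i)
        rw [sub_eq_zero, Real.sqrt_eq_one] at h3
        have h4 := hv.norm_sq_apply i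
        simp only [LinearMap.zero_apply, OrthonormalBasis.coe_toBasis]
        rw [← norm_eq_zero, ← sq_eq_zero_iff, h4]
        linarith
      rw [key A₀ e0, key A₁ e1]
      simp

/-- A gradient bound common to the four classes, needed for dominated convergence. -/
lemma norm_apply_le_two (hm : Module.finrank ℝ E = m) (A : E →ₗ[ℝ] W)
    (h : (∀ i : Fin m, A.singularValues i ≤ 1) ∨ (∑ i : Fin m, A.singularValues i ≤ 2) ∨
      (∑ i : Fin m, A.singularValues i ^ 2 ≤ 2) ∨
      (∑ i : Fin m, √(1 + A.singularValues i ^ 2) ≤ 2)) (x : E) : ‖A x‖ ≤ 2 * ‖x‖ := by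
  obtain ⟨v, hv⟩ := exists_isSingularBasis hm A
  refine hv.norm_apply_le (fun i => ?_) zero_le_two x
  have h0 := hv.nonneg i
  rcases h with h | h | h | h
  · linarith [h i]
  · exact (Finset.single_le_sum (f := fun i : Fin m => A.singularValues i)
      (fun i _ => hv.nonneg i) (Finset.mem_univ i)).trans h
  · have := (Finset.single_le_sum (f := fun i : Fin m => A.singularValues i ^ 2)
      (fun i _ => sq_nonneg _) (Finset.mem_univ i)).trans h
    nlinarith
  · have := (Finset.single_le_sum (f := fun i : Fin m => √(1 + A.singularValues i ^ 2))
      (fun i _ => Real.sqrt_nonneg _) (Finset.mem_univ i)).trans h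
    refine le_trans ?_ this
    exact Real.le_sqrt_of_sq_le (by linarith)

lemma fderiv_gramDensity_mono_clm
    (w : OrthonormalBasis (Fin m) ℝ E) (A₀ A₁ : E →L[ℝ] W)
    (h : ((∀ i : Fin m, A₀.toLinearMap.singularValues i ≤ 1) ∧
        ∀ i : Fin m, A₁.toLinearMap.singularValues i ≤ 1) ∨
      (∑ i : Fin m, A₀.toLinearMap.singularValues i ≤ 2 ∧
        ∑ i : Fin m, A₁.toLinearMap.singularValues i ≤ 2) ∨
      (∑ i : Fin m, A₀.toLinearMap.singularValues i ^ 2 ≤ 2 ∧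
        ∑ i : Fin m, A₁.toLinearMap.singularValues i ^ 2 ≤ 2) ∨
      (∑ i : Fin m, √(1 + A₀.toLinearMap.singularValues i ^ 2) ≤ 2 ∧
        ∑ i : Fin m, √(1 + A₁.toLinearMap.singularValues i ^ 2) ≤ 2)) :
    0 ≤ (fderiv ℝ gramDensity (fun i => A₁ (w i)) - fderiv ℝ gramDensity (fun i => A₀ (w i)))
        (fun i => (A₁ - A₀) (w i)) ∧
      ((fderiv ℝ gramDensity (fun i => A₁ (w i)) - fderiv ℝ gramDensity (fun i => A₀ (w i)))
        (fun i => (A₁ - A₀) (w i)) = 0 → A₁ = A₀) := by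
  obtain ⟨h1, h2⟩ := fderiv_gramDensity_mono (by simpa using Module.finrank_eq_card_basis w.toBasis) w A₀.toLinearMap A₁.toLinearMap h
  exact ⟨h1, fun h0 => ContinuousLinearMap.coe_injective (h2 h0).symm⟩

lemma norm_comp_orthonormalBasis_le_two
    (w : OrthonormalBasis (Fin m) ℝ E) (A : E →L[ℝ] W)
    (h : (∀ i : Fin m, A.toLinearMap.singularValues i ≤ 1) ∨
      (∑ i : Fin m, A.toLinearMap.singularValues i ≤ 2) ∨
      (∑ i : Fin m, A.toLinearMap.singularValues i ^ 2 ≤ 2) ∨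
      (∑ i : Fin m, √(1 + A.toLinearMap.singularValues i ^ 2) ≤ 2)) :
    ‖fun i => A (w i)‖ ≤ 2 := by
  rw [pi_norm_le_iff_of_nonneg zero_le_two]
  intro i
  have := norm_apply_le_two (by simpa using Module.finrank_eq_card_basis w.toBasis) A.toLinearMap h (w i)
  rwa [w.norm_eq_one, mul_one] at this

end Monotonicity

/-! ### Gram-Schmidt with continuous coefficients. -/

section GramSchmidt

open InnerProductSpace

variable {m : ℕ} {X : Type*} [TopologicalSpace X] {V : X → Type*} [∀ x, NormedAddCommGroup (V x)]
  [∀ x, InnerProductSpace ℝ (V x)] {s : ∀ x, Fin m → V x} {S : Set X}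

/-- The Gram-Schmidt process has coefficients depending continuously on a family of frames. -/
lemma exists_gramSchmidt_eq_sum
    (hs : ∀ i j, ContinuousOn (fun x => inner ℝ (s x i) (s x j)) S)
    (hl : ∀ x ∈ S, LinearIndependent ℝ (s x)) (i : Fin m) : ∃ k : Fin m → X → ℝ,
    (∀ j, ContinuousOn (k j) S) ∧ ∀ x ∈ S, gramSchmidt ℝ (s x) i = ∑ j, k j x • s x j := by
  induction i using WellFoundedLT.induction with
  | ind i ih =>
    choose! k hk hk' using ih
    have hinner : ∀ l < i, ∀ j, ContinuousOn (fun x => inner ℝ (gramSchmidt ℝ (s x) l) (s x j)) S :=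
      fun l hl j => by
        have : ContinuousOn (fun x => ∑ j', k l j' x * inner ℝ (s x j') (s x j)) S :=
          continuousOn_finsetSum _ fun j' _ => (hk l hl j').mul (hs j' j)
        refine this.congr fun x hx => ?_
        simp only [hk' l hl x hx, sum_inner, inner_smul_left, conj_trivial]
    have hnorm : ∀ l < i, ContinuousOn (fun x => ‖gramSchmidt ℝ (s x) l‖ ^ 2) S := fun l hl => by
      have : ContinuousOn (fun x => ∑ j', k l j' x * inner ℝ (gramSchmidt ℝ (s x) l) (s x j')) S :=
        continuousOn_finsetSum _ fun j' _ => (hk l hl j').mul (hinner l hl j')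
      refine this.congr fun x hx => ?_
      have h2 : inner ℝ (gramSchmidt ℝ (s x) l) (∑ j, k l j x • s x j) =
          ∑ j', k l j' x * inner ℝ (gramSchmidt ℝ (s x) l) (s x j') := by
        simp only [inner_sum, inner_smul_right]
      simp only [← h2, ← hk' l hl x hx, real_inner_self_eq_norm_sq]
    refine ⟨fun j x => (if j = i then 1 else 0) - ∑ l ∈ Finset.Iio i,
      inner ℝ (gramSchmidt ℝ (s x) l) (s x i) / ‖gramSchmidt ℝ (s x) l‖ ^ 2 * k l j x, fun j => ?_,
      fun x hx => ?_⟩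
    · refine continuousOn_const.sub (continuousOn_finsetSum _ fun l hli => ?_)
      have hli := Finset.mem_Iio.1 hli
      refine ((hinner l hli i).div (hnorm l hli) fun x hx => ?_).mul (hk l hli j)
      exact pow_ne_zero 2 (norm_ne_zero_iff.2 (gramSchmidt_ne_zero l (hl x hx)))
    · have h := gramSchmidt_def'' ℝ (s x) i
      rw [← sub_eq_iff_eq_add] at h
      rw [← h]
      simp only [sub_smul, Finset.sum_sub_distrib, ite_smul, one_smul, zero_smul,
        Finset.sum_ite_eq', Finset.mem_univ, if_true, Finset.sum_smul]
      congr 1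
      rw [Finset.sum_comm]
      refine Finset.sum_congr rfl fun l hli => ?_
      simp only [mul_smul]
      rw [← Finset.smul_sum, ← hk' l (Finset.mem_Iio.1 hli) x hx]
      rfl

lemma exists_orthonormalBasis_eq_sum [∀ x, FiniteDimensional ℝ (V x)]
    (hd : ∀ x, Module.finrank ℝ (V x) = m)
    (hs : ∀ i j, ContinuousOn (fun x => inner ℝ (s x i) (s x j)) S)
    (hl : ∀ x ∈ S, LinearIndependent ℝ (s x)) :
    ∃ o : ∀ x, OrthonormalBasis (Fin m) ℝ (V x), ∃ k : Fin m → Fin m → X → ℝ,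
      (∀ i j, ContinuousOn (k i j) S) ∧ ∀ x ∈ S, ∀ i, o x i = ∑ j, k i j x • s x j := by
  choose k hk hk' using exists_gramSchmidt_eq_sum hs hl
  have hcard : ∀ x, Module.finrank ℝ (V x) = Fintype.card (Fin m) :=
    fun x => by rw [hd, Fintype.card_fin]
  have hnorm : ∀ i, ContinuousOn (fun x => ‖gramSchmidt ℝ (s x) i‖) S := fun i => by
    have : ContinuousOn (fun x => √(∑ j, k i j x * ∑ j', k i j' x * inner ℝ (s x j') (s x j))) S :=
      (continuousOn_finsetSum _ fun j _ => (hk i j).mul (continuousOn_finsetSum _ fun j' _ =>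
        (hk i j').mul (hs j' j))).sqrt
    refine this.congr fun x hx => ?_
    simp only [norm_eq_sqrt_real_inner, hk' i x hx, sum_inner, inner_sum, inner_smul_left,
      inner_smul_right, conj_trivial]
  refine ⟨fun x => gramSchmidtOrthonormalBasis (hcard x) (s x),
    fun i j x => ‖gramSchmidt ℝ (s x) i‖⁻¹ * k i j x,
    fun i j => ((hnorm i).inv₀ fun x hx => norm_ne_zero_iff.2
      (gramSchmidt_ne_zero i (hl x hx))).mul (hk i j), fun x hx i => ?_⟩
  have hne := gramSchmidtNormed_unit_length i (hl x hx)
  rw [gramSchmidtOrthonormalBasis_apply _ (norm_ne_zero_iff.1 (by rw [hne]; exact one_ne_zero)),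
    gramSchmidtNormed]
  simp only [mul_smul]
  rw [← Finset.smul_sum, ← hk' i x hx]
  rfl

end GramSchmidt

/-! ### Coordinate frames and continuity of the area integrands. -/

section ChartFrame

variable {m : ℕ} {M : Type*} [TopologicalSpace M] [ChartedSpace (Euc m) M]

lemma finrank_tangentSpace (x : M) : Module.finrank ℝ (TangentSpace 𝓘(ℝ, Euc m) x) = m :=
  finrank_euclideanSpace_fin

variable [IsManifold 𝓘(ℝ, Euc m) ∞ M]

/-- The frame `∂/∂xⁱ` of the tangent bundle over the domain of the chart at `c`. -/
noncomputable def chartFrame (c x : M) (i : Fin m) : TangentSpace 𝓘(ℝ, Euc m) x :=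
  haveI : IsManifold 𝓘(ℝ, Euc m) 1 M := IsManifold.of_le (n := ∞) (by simp)
  (trivializationAt (Euc m) (TangentSpace 𝓘(ℝ, Euc m) (M := M)) c).symmL ℝ x
    (EuclideanSpace.single i (1 : ℝ))

/-- Links the bundle description, convenient for continuity of inner products, with the derivative
of the inverse chart, needed for the chain rule and the volume. -/
lemma chartFrame_eq {c x : M} (hx : x ∈ (chartAt (Euc m) c).source) (i : Fin m) :
    chartFrame c x i = mfderiv 𝓘(ℝ, Euc m) 𝓘(ℝ, Euc m) (chartAt (Euc m) c).symm
      (chartAt (Euc m) c x) (EuclideanSpace.single i (1 : ℝ) : Euc m) := by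
  have : IsManifold 𝓘(ℝ, Euc m) 1 M := IsManifold.of_le (n := ∞) (by simp)
  unfold chartFrame
  rw [TangentBundle.symmL_trivializationAt hx]
  simp only [mfld_simps, mfderivWithin_univ]
  rfl

lemma linearIndependent_chartFrame {c x : M} (hx : x ∈ (chartAt (Euc m) c).source) :
    LinearIndependent ℝ (chartFrame (m := m) c x) := by
  have : IsManifold 𝓘(ℝ, Euc m) 1 M := IsManifold.of_le (n := ∞) (by simp)
  have h1 : LinearIndependent ℝ (fun i : Fin m => (EuclideanSpace.single i (1 : ℝ) : Euc m)) := by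
    have := (EuclideanSpace.basisFun (Fin m) ℝ).toBasis.linearIndependent
    rw [OrthonormalBasis.coe_toBasis] at this
    have he : (fun i : Fin m => (EuclideanSpace.single i (1 : ℝ) : Euc m)) =
        EuclideanSpace.basisFun (Fin m) ℝ := by
      ext1 i
      simp
    rw [he]
    exact this
  refine h1.map' ((trivializationAt (Euc m) (TangentSpace 𝓘(ℝ, Euc m) (M := M)) c).symmL ℝ
    x).toLinearMap (LinearMap.ker_eq_bot.2 ?_)
  refine Function.LeftInverse.injective (g := (trivializationAt (Euc m)
    (TangentSpace 𝓘(ℝ, Euc m) (M := M)) c).continuousLinearMapAt ℝ x) fun y => ?_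
  exact Bundle.Trivialization.continuousLinearMapAt_symmL _ (by simpa using hx) y

lemma continuousOn_chartFrame (c : M) (i : Fin m) :
    ContinuousOn (fun x : M => (⟨x, chartFrame c x i⟩ :
      TotalSpace (Euc m) (TangentSpace 𝓘(ℝ, Euc m) (M := M)))) (chartAt (Euc m) c).source := by
  have : IsManifold 𝓘(ℝ, Euc m) 1 M := IsManifold.of_le (n := ∞) (by simp)
  set e := trivializationAt (Euc m) (TangentSpace 𝓘(ℝ, Euc m) (M := M)) c with he
  have hb : e.baseSet = (chartAt (Euc m) c).source := by simp [he]
  have h1 := e.continuousOn_symm.comp (s := e.baseSet)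
    (continuousOn_id.prodMk (continuousOn_const (c := (EuclideanSpace.single i (1 : ℝ) : Euc m))))
    fun x hx => ⟨hx, mem_univ _⟩
  rw [← hb]
  refine h1.congr fun x hx => ?_
  simp only [Function.comp_apply, id_eq]
  congr 1
  exact Bundle.Trivialization.symmL_apply e hx _

lemma continuousOn_mapDifferential_chartFrame {n : ℕ} {D : Set M} (hD : IsOpen D) {f : M → Euc n}
    (hf : ContMDiffOn 𝓘(ℝ, Euc m) 𝓘(ℝ, Euc n) ∞ f D) (c : M) (i : Fin m) :
    ContinuousOn (fun x => mapDifferential f x (chartFrame c x i))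
      ((chartAt (Euc m) c).source ∩ D) := by
  set φ := chartAt (Euc m) c
  have hopen : IsOpen (φ.target ∩ φ.symm ⁻¹' D) := φ.isOpen_inter_preimage_symm hD
  have h1 : ContDiffOn ℝ ∞ (f ∘ φ.symm) (φ.target ∩ φ.symm ⁻¹' D) := by
    rw [← contMDiffOn_iff_contDiffOn]
    exact hf.comp (contMDiffOn_chart_symm.mono inter_subset_left) fun y hy => hy.2
  have h2 : ContinuousOn (fun x => fderiv ℝ (f ∘ φ.symm) (φ x)
      (EuclideanSpace.single i (1 : ℝ) : Euc m)) (φ.source ∩ D) := by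
    refine ContinuousOn.clm_apply ?_ continuousOn_const
    refine (h1.continuousOn_fderiv_of_isOpen hopen (by simp)).comp
      (φ.continuousOn.mono inter_subset_left) fun x hx => ⟨φ.map_source hx.1, ?_⟩
    rw [mem_preimage, φ.left_inv hx.1]
    exact hx.2
  refine h2.congr fun x hx => ?_
  have hs : MDifferentiableAt 𝓘(ℝ, Euc m) 𝓘(ℝ, Euc m) φ.symm (φ x) :=
    (contMDiffOn_chart_symm (n := ∞) (x := c)).contMDiffAt
      (φ.open_target.mem_nhds (φ.map_source hx.1)) |>.mdifferentiableAt (by simp)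
  have hfd : MDifferentiableAt 𝓘(ℝ, Euc m) 𝓘(ℝ, Euc n) f (φ.symm (φ x)) := by
    rw [φ.left_inv hx.1]
    exact (hf.contMDiffAt (hD.mem_nhds hx.2)).mdifferentiableAt (by simp)
  have h3 : fderiv ℝ (f ∘ φ.symm) (φ x) (EuclideanSpace.single i (1 : ℝ) : Euc m) =
      mapDifferential f (φ.symm (φ x)) (mfderiv 𝓘(ℝ, Euc m) 𝓘(ℝ, Euc m) φ.symm (φ x)
        (EuclideanSpace.single i (1 : ℝ) : Euc m)) := by
    have := mfderiv_comp (φ x) hfd hs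
    rw [mfderiv_eq_fderiv] at this
    exact DFunLike.congr_fun this (EuclideanSpace.single i (1 : ℝ) : Euc m)
  -- The base points `φ.symm (φ x)` and `x` agree only propositionally; the comparison is made in
  -- the model space, with which every tangent space is identified by definition.
  have hcast : ∀ x' : M, x' = x → ∀ v : Euc m,
      (mapDifferential (m := m) f x' : Euc m → Euc n) v =
        (mapDifferential (m := m) f x : Euc m → Euc n) v := by
    rintro x' rfl v
    rfl
  refine Eq.trans ?_ h3.symm
  rw [chartFrame_eq hx.1]
  exact (hcast _ (φ.left_inv hx.1) _).symm

section Metric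

variable [RiemannianBundle (fun x : M => TangentSpace 𝓘(ℝ, Euc m) x)]
  [IsContMDiffRiemannianBundle 𝓘(ℝ, Euc m) ∞ (Euc m) (fun x : M => TangentSpace 𝓘(ℝ, Euc m) x)]

lemma continuousOn_inner_chartFrame (c : M) (i j : Fin m) :
    ContinuousOn (fun x => inner ℝ (chartFrame c x i) (chartFrame c x j))
      (chartAt (Euc m) c).source := by
  have : IsManifold 𝓘(ℝ, Euc m) 1 M := IsManifold.of_le (n := ∞) (by simp)
  have : IsContinuousRiemannianBundle (Euc m) (fun x : M => TangentSpace 𝓘(ℝ, Euc m) x) := by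
    obtain ⟨g, hg, hg'⟩ := IsContMDiffRiemannianBundle.exists_contMDiff (IB := 𝓘(ℝ, Euc m))
      (n := ∞) (F := Euc m) (E := fun x : M => TangentSpace 𝓘(ℝ, Euc m) x)
    exact ⟨g, hg.continuous, hg'⟩
  exact (continuousOn_chartFrame c i).inner_bundle (continuousOn_chartFrame c j)

/-- Over a chart domain there is an orthonormal frame with continuous coefficients with respect to
the coordinate frame. -/
lemma exists_orthonormalBasis_chartFrame_eq (c : M) :
    ∃ o : ∀ x : M, OrthonormalBasis (Fin m) ℝ (TangentSpace 𝓘(ℝ, Euc m) x),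
    ∃ k : Fin m → Fin m → M → ℝ, (∀ i j, ContinuousOn (k i j) (chartAt (Euc m) c).source) ∧
      ∀ x ∈ (chartAt (Euc m) c).source, ∀ i, o x i = ∑ j, k i j x • chartFrame c x j :=
  exists_orthonormalBasis_eq_sum (V := fun x : M => TangentSpace 𝓘(ℝ, Euc m) x)
    finrank_tangentSpace (continuousOn_inner_chartFrame c)
    fun _ hx => linearIndependent_chartFrame hx

variable {n : ℕ} {D : Set M} (b : ∀ x : M, OrthonormalBasis (Fin m) ℝ (TangentSpace 𝓘(ℝ, Euc m) x))

/-- The bases `b x` carry no continuity in x. Locally they are exchanged for a Gram-Schmidt frame,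
which leaves the density unchanged. -/
lemma continuousOn_comp_gramDensity
    {α : ∀ x : M, TangentSpace 𝓘(ℝ, Euc m) x →L[ℝ] Euc n}
    (hα : ∀ c i, ContinuousOn (fun x => α x (chartFrame c x i)) ((chartAt (Euc m) c).source ∩ D)) :
    ContinuousOn (fun x => gramDensity (fun i => α x (b x i))) D := by
  intro x₀ hx₀
  obtain ⟨o, k, hk, hk'⟩ := exists_orthonormalBasis_chartFrame_eq (m := m) x₀
  set s := (chartAt (Euc m) x₀).source
  have hs : s ∈ 𝓝[D] x₀ := mem_nhdsWithin_of_mem_nhds (chart_source_mem_nhds (Euc m) x₀)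
  suffices ContinuousOn (fun x => gramDensity (fun i => α x (b x i))) (s ∩ D) by
    have h1 := this x₀ ⟨mem_chart_source _ _, hx₀⟩
    rwa [ContinuousWithinAt, nhdsWithin_inter_of_mem hs] at h1
  have h : ContinuousOn (fun x => gramDensity (fun i => ∑ j, k i j x • α x (chartFrame x₀ x j)))
      (s ∩ D) :=
    contDiff_gramDensity.continuous.comp_continuousOn (continuousOn_pi.2 fun i =>
      continuousOn_finsetSum _ fun j _ => ((hk i j).mono inter_subset_left).smul (hα x₀ j))
  refine h.congr fun x hx => ?_
  have h2 := gramDensity_comp_eq (α x).toLinearMap (b x) (o x)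
  simp only [ContinuousLinearMap.coe_coe] at h2
  simp only [h2, hk' x hx.1, map_sum, map_smul]

lemma continuousOn_comp_fderiv_gramDensity
    {α β : ∀ x : M, TangentSpace 𝓘(ℝ, Euc m) x →L[ℝ] Euc n}
    (hα : ∀ c i, ContinuousOn (fun x => α x (chartFrame c x i)) ((chartAt (Euc m) c).source ∩ D))
    (hβ : ∀ c i, ContinuousOn (fun x => β x (chartFrame c x i)) ((chartAt (Euc m) c).source ∩ D)) :
    ContinuousOn (fun x => fderiv ℝ gramDensity (fun i => α x (b x i)) (fun i => β x (b x i))) D := by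
  intro x₀ hx₀
  obtain ⟨o, k, hk, hk'⟩ := exists_orthonormalBasis_chartFrame_eq (m := m) x₀
  set s := (chartAt (Euc m) x₀).source
  have hs : s ∈ 𝓝[D] x₀ := mem_nhdsWithin_of_mem_nhds (chart_source_mem_nhds (Euc m) x₀)
  suffices ContinuousOn (fun x => fderiv ℝ gramDensity (fun i => α x (b x i))
      (fun i => β x (b x i))) (s ∩ D) by
    have h1 := this x₀ ⟨mem_chart_source _ _, hx₀⟩
    rwa [ContinuousWithinAt, nhdsWithin_inter_of_mem hs] at h1
  have h : ContinuousOn (fun x => fderiv ℝ gramDensity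
      (fun i => ∑ j, k i j x • α x (chartFrame x₀ x j))
      (fun i => ∑ j, k i j x • β x (chartFrame x₀ x j))) (s ∩ D) := by
    refine ContinuousOn.clm_apply ((contDiff_gramDensity.continuous_fderiv
      (by simp)).comp_continuousOn (continuousOn_pi.2 fun i => ?_)) (continuousOn_pi.2 fun i => ?_)
    · exact continuousOn_finsetSum _ fun j _ =>
        ((hk i j).mono inter_subset_left).smul (hα x₀ j)
    · exact continuousOn_finsetSum _ fun j _ =>
        ((hk i j).mono inter_subset_left).smul (hβ x₀ j)
  refine h.congr fun x hx => ?_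
  have h2 := fderiv_gramDensity_comp_eq (α x).toLinearMap (β x).toLinearMap (b x) (o x)
  simp only [ContinuousLinearMap.coe_coe] at h2
  simp only [h2, hk' x hx.1, map_sum, map_smul]

end Metric

end ChartFrame

/-! ### The volume is finite on compact sets and positive on nonempty open sets. -/

section RiemannianVolume

variable {m : ℕ} {M : Type*} [TopologicalSpace M] [ChartedSpace (Euc m) M]
  [IsManifold 𝓘(ℝ, Euc m) ∞ M]
  [RiemannianBundle (fun x : M => TangentSpace 𝓘(ℝ, Euc m) x)]

omit [RiemannianBundle (fun x : M => TangentSpace 𝓘(ℝ, Euc m) x)] in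
lemma coordVector_eq_chartFrame {c : M} {y : Euc m} (hy : y ∈ (chartAt (Euc m) c).target)
    (i : Fin m) : coordVector c y i = chartFrame c ((chartAt (Euc m) c).symm y) i := by
  rw [chartFrame_eq ((chartAt (Euc m) c).map_target hy)]
  have hcast : ∀ y' : Euc m, y' = y → (coordVector c y i : Euc m) = (coordVector c y' i : Euc m) := by
    rintro y' rfl
    rfl
  exact hcast _ ((chartAt (Euc m) c).right_inv hy)

lemma chartMetric_eq_gram {c : M} {y : Euc m} (hy : y ∈ (chartAt (Euc m) c).target) :
    chartMetric c y = Matrix.gram ℝ (chartFrame (m := m) c ((chartAt (Euc m) c).symm y)) := by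
  ext i j
  simp only [chartMetric, Matrix.of_apply, Matrix.gram_apply, coordVector_eq_chartFrame hy]

lemma chartMetric_det_pos {c : M} {y : Euc m} (hy : y ∈ (chartAt (Euc m) c).target) :
    0 < (chartMetric c y).det := by
  rw [chartMetric_eq_gram hy]
  have hp : (Matrix.gram ℝ (chartFrame (m := m) c ((chartAt (Euc m) c).symm y))).PosDef :=
    Matrix.posDef_gram_of_linearIndependent
      (linearIndependent_chartFrame ((chartAt (Euc m) c).map_target hy))
  exact hp.det_pos

variable [IsContMDiffRiemannianBundle 𝓘(ℝ, Euc m) ∞ (Euc m)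
  (fun x : M => TangentSpace 𝓘(ℝ, Euc m) x)]

lemma continuousOn_sqrt_chartMetric_det (c : M) :
    ContinuousOn (fun y => √(chartMetric (m := m) c y).det) (chartAt (Euc m) c).target := by
  have hent : ∀ i j, ContinuousOn (fun y => chartMetric (m := m) c y i j)
      (chartAt (Euc m) c).target := fun i j => by
    refine ((continuousOn_inner_chartFrame c i j).comp (chartAt (Euc m) c).continuousOn_symm
      fun y hy => (chartAt (Euc m) c).map_target hy).congr fun y hy => ?_
    rw [chartMetric_eq_gram hy]
    rfl
  simp only [Matrix.det_apply]
  exact (continuousOn_finsetSum _ fun σ _ =>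
    (continuousOn_finsetProd _ fun i _ => hent (σ i) i).const_smul _).sqrt

variable [MeasurableSpace M] [BorelSpace M]

omit [IsContMDiffRiemannianBundle 𝓘(ℝ, Euc m) ∞ (Euc m)
  (fun x : M => TangentSpace 𝓘(ℝ, Euc m) x)] [IsManifold 𝓘(ℝ, Euc m) ∞ M] in
lemma chartVolume_apply (c : M) {s : Set M} (hs : MeasurableSet s) :
    chartVolume (m := m) c s = ∫⁻ y in (chartAt (Euc m) c).target ∩ (chartAt (Euc m) c).symm ⁻¹' s,
      ENNReal.ofReal (√(chartMetric c y).det) := by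
  have hm : AEMeasurable (chartAt (Euc m) c).symm
      ((volume : Measure (Euc m)).restrict (chartAt (Euc m) c).target) :=
    (chartAt (Euc m) c).continuousOn_symm.aemeasurable (chartAt (Euc m) c).open_target.measurableSet
  unfold chartVolume
  rw [Measure.map_apply_of_aemeasurable (hm.mono_ac (withDensity_absolutelyContinuous _ _)) hs,
    withDensity_apply', Measure.restrict_restrict' (chartAt (Euc m) c).open_target.measurableSet,
    inter_comm]

variable [T2Space M]

lemma chartVolume_lt_top_of_isCompact {c : M} {K : Set M} (hK : IsCompact K)
    (hKc : K ⊆ (chartAt (Euc m) c).source) : chartVolume (m := m) c K < ⊤ := by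
  rw [chartVolume_apply c hK.measurableSet]
  set φ := chartAt (Euc m) c
  have himg : φ.target ∩ φ.symm ⁻¹' K = φ '' K := (φ.image_eq_target_inter_inv_preimage hKc).symm
  have hcpt : IsCompact (φ '' K) := hK.image_of_continuousOn (φ.continuousOn.mono hKc)
  rw [himg]
  obtain ⟨C, hC⟩ := hcpt.exists_bound_of_continuousOn
    ((continuousOn_sqrt_chartMetric_det (m := m) c).mono (by rw [← himg]; exact inter_subset_left))
  refine setLIntegral_lt_top_of_le_nnreal hcpt.measure_lt_top.ne ⟨C.toNNReal, fun y hy => ?_⟩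
  exact ENNReal.ofReal_le_ofReal ((le_abs_self _).trans (hC y hy))

omit [T2Space M] in
lemma chartVolume_ne_zero_of_isOpen {c : M} {U : Set M} (hU : IsOpen U) {x : M} (hx : x ∈ U)
    (hxc : x ∈ (chartAt (Euc m) c).source) : chartVolume (m := m) c U ≠ 0 := by
  rw [chartVolume_apply c hU.measurableSet]
  set φ := chartAt (Euc m) c
  have hopen : IsOpen (φ.target ∩ φ.symm ⁻¹' U) := φ.isOpen_inter_preimage_symm hU
  have hne : (φ.target ∩ φ.symm ⁻¹' U).Nonempty :=
    ⟨φ x, φ.map_source hxc, by rwa [mem_preimage, φ.left_inv hxc]⟩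
  have hae : AEMeasurable (fun y => ENNReal.ofReal (√(chartMetric (m := m) c y).det))
      ((volume : Measure (Euc m)).restrict (φ.target ∩ φ.symm ⁻¹' U)) :=
    (((continuousOn_sqrt_chartMetric_det (m := m) c).mono inter_subset_left).aemeasurable
      hopen.measurableSet).ennreal_ofReal
  rw [Ne, setLIntegral_eq_zero_iff' hopen.measurableSet hae]
  intro h0
  refine hopen.measure_ne_zero volume hne (measure_mono_null (fun y hy => ?_) h0)
  simp only [mem_compl_iff, mem_ofPred_eq, ENNReal.ofReal_eq_zero, not_forall, not_le]
  exact ⟨hy, Real.sqrt_pos.2 (chartMetric_det_pos hy.1)⟩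

variable [SigmaCompactSpace M]

/-- Only finitely many partition functions meet K, and each contributes at most the chart volume of
a compact subset of its chart domain. -/
lemma isFiniteMeasureOnCompacts_riemannianVolume :
    IsFiniteMeasureOnCompacts (riemannianVolume m M) := by
  refine ⟨fun K hK => ?_⟩
  set ρ := chartPartition m M
  have hsub : ρ.IsSubordinate fun c => (chartAt (Euc m) c).source :=
    (SmoothPartitionOfUnity.exists_isSubordinate_chartAt_source 𝓘(ℝ, Euc m) M).choose_spec
  have hfin := ρ.locallyFinite.finite_nonempty_inter_compact hK
  unfold riemannianVolume
  rw [Measure.sum_apply _ hK.measurableSet, tsum_eq_sum (s := hfin.toFinset)]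
  · refine ENNReal.sum_lt_top.2 fun c _ => ?_
    rw [withDensity_apply _ hK.measurableSet]
    have hle : ∀ x, ENNReal.ofReal (ρ c x) ≤ (tsupport (ρ c)).indicator 1 x := fun x => by
      by_cases hx : x ∈ tsupport (ρ c)
      · rw [indicator_of_mem hx]
        exact ENNReal.ofReal_le_one.2 (ρ.le_one c x)
      · rw [image_eq_zero_of_notMem_tsupport hx]
        simp
    refine (lintegral_mono hle).trans_lt ?_
    rw [lintegral_indicator_one (isClosed_tsupport _).measurableSet,
      Measure.restrict_apply (isClosed_tsupport _).measurableSet]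
    exact chartVolume_lt_top_of_isCompact (hK.inter_left (isClosed_tsupport _))
      (inter_subset_left.trans (hsub c))
  · intro c hc
    rw [withDensity_apply _ hK.measurableSet]
    refine (setLIntegral_congr_fun hK.measurableSet fun x hx => ?_).trans lintegral_zero
    have : ρ c x = 0 := by
      by_contra hne
      exact hc (hfin.mem_toFinset.2 ⟨x, hne, hx⟩)
    change ENNReal.ofReal (ρ c x) = 0
    rw [this, ENNReal.ofReal_zero]

/-- Some partition function is positive near a given point, where the chart density is positive too.
-/
lemma isOpenPosMeasure_riemannianVolume : (riemannianVolume m M).IsOpenPosMeasure := by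
  refine ⟨fun U hU ⟨x, hx⟩ h0 => ?_⟩
  set ρ := chartPartition m M
  have hsub : ρ.IsSubordinate fun c => (chartAt (Euc m) c).source :=
    (SmoothPartitionOfUnity.exists_isSubordinate_chartAt_source 𝓘(ℝ, Euc m) M).choose_spec
  obtain ⟨c, hc⟩ := ρ.exists_pos_of_mem (mem_univ x)
  unfold riemannianVolume at h0
  rw [Measure.sum_apply _ hU.measurableSet, ENNReal.tsum_eq_zero] at h0
  have hcont : Continuous (ρ c) := (ρ c).contMDiff.continuous
  have h1 := h0 c
  rw [withDensity_apply_eq_zero hcont.measurable.ennreal_ofReal] at h1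
  have hset : {x | ENNReal.ofReal (ρ c x) ≠ 0} = {x | 0 < ρ c x} := by
    ext x
    simp
  rw [hset] at h1
  exact chartVolume_ne_zero_of_isOpen ((isOpen_lt continuous_const hcont).inter hU) ⟨hc, hx⟩
    (hsub c (subset_tsupport _ hc.ne')) h1

end RiemannianVolume

/-! ### A smooth cutoff in the target space. -/

section Cutoff

variable {W : Type*} [NormedAddCommGroup W] [InnerProductSpace ℝ W]

/-- A smooth map that vanishes on the unit ball and is the identity outside the ball of
radius `2`. -/
noncomputable def cutoffMap (v : W) : W := Real.smoothTransition (‖v‖ ^ 2 - 1) • v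

lemma contDiff_cutoffMap : ContDiff ℝ ∞ (cutoffMap : W → W) :=
  (Real.smoothTransition.contDiff.comp ((contDiff_norm_sq ℝ).sub contDiff_const)).smul contDiff_id

lemma cutoffMap_eq_zero {v : W} (hv : ‖v‖ ≤ 1) : cutoffMap v = 0 := by
  rw [cutoffMap, Real.smoothTransition.zero_of_nonpos, zero_smul]
  nlinarith [norm_nonneg v]

lemma fderiv_cutoffMap_eq_zero {v : W} (hv : ‖v‖ < 1) : fderiv ℝ cutoffMap v = 0 := by
  have : (cutoffMap : W → W) =ᶠ[𝓝 v] fun _ => 0 := by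
    filter_upwards [(isOpen_lt continuous_norm continuous_const).mem_nhds hv] with u hu
    exact cutoffMap_eq_zero (le_of_lt hu)
  rw [this.fderiv_eq]
  simp

lemma fderiv_cutoffMap_eq_id {v : W} (hv : 2 < ‖v‖) :
    fderiv ℝ cutoffMap v = ContinuousLinearMap.id ℝ W := by
  have : (cutoffMap : W → W) =ᶠ[𝓝 v] fun u => u := by
    filter_upwards [(isOpen_lt continuous_const continuous_norm).mem_nhds hv] with u hu
    have hu : 2 < ‖u‖ := hu
    rw [cutoffMap, Real.smoothTransition.one_of_one_le, one_smul]
    nlinarith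
  rw [this.fderiv_eq]
  exact fderiv_fun_id

lemma exists_norm_fderiv_cutoffMap_le [FiniteDimensional ℝ W] :
    ∃ C : ℝ, 0 ≤ C ∧ ∀ v : W, ‖fderiv ℝ cutoffMap v‖ ≤ C := by
  have : ProperSpace W := FiniteDimensional.proper_real W
  obtain ⟨C, hC⟩ := (isCompact_closedBall (0 : W) 2).exists_bound_of_continuousOn
    (contDiff_cutoffMap.continuous_fderiv (by simp)).continuousOn
  refine ⟨max C 1, le_max_of_le_right zero_le_one, fun v => ?_⟩
  by_cases hv : ‖v‖ ≤ 2
  · exact (hC v (by simpa using hv)).trans (le_max_left _ _)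
  · rw [fderiv_cutoffMap_eq_id (not_le.1 hv)]
    exact ContinuousLinearMap.norm_id_le.trans (le_max_right _ _)

/-- The rescaled cut-off map. -/
noncomputable def scaledCutoff (r : ℝ) (v : W) : W := r⁻¹ • cutoffMap (r • v)

lemma contDiff_scaledCutoff (r : ℝ) : ContDiff ℝ ∞ (scaledCutoff r : W → W) :=
  (contDiff_cutoffMap.comp (contDiff_id.const_smul r)).const_smul r⁻¹

/-- The two scalings cancel in the derivative, so its bound is uniform in r while the region of
cutoff shrinks to the origin. -/
lemma fderiv_scaledCutoff {r : ℝ} (hr : r ≠ 0) (v : W) :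
    fderiv ℝ (scaledCutoff r) v = fderiv ℝ cutoffMap (r • v) := by
  have h1 : HasFDerivAt (fun u : W => r • u) (r • ContinuousLinearMap.id ℝ W) v :=
    (hasFDerivAt_id v).const_smul r
  have h2 := ((contDiff_cutoffMap.differentiable (by simp) (r • v)).hasFDerivAt.comp v
    h1).const_smul r⁻¹
  refine h2.fderiv.trans ?_
  ext u
  simp [smul_smul, hr]

end Cutoff

/-! ### The weak Euler-Lagrange equation. -/

section FirstVariation

variable {m n : ℕ} {M : Type*} [TopologicalSpace M] [ChartedSpace (Euc m) M]

lemma mapDifferential_add_smul {f g : M → Euc n} {x : M}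
    (hf : MDifferentiableAt 𝓘(ℝ, Euc m) 𝓘(ℝ, Euc n) f x)
    (hg : MDifferentiableAt 𝓘(ℝ, Euc m) 𝓘(ℝ, Euc n) g x) (t : ℝ) :
    mapDifferential (m := m) (fun y => f y + t • g y) x =
      mapDifferential f x + t • mapDifferential g x := by
  unfold mapDifferential
  have h1 := mfderiv_add hf (hg.const_smul t)
  rw [const_smul_mfderiv hg t] at h1
  exact h1

lemma mapDifferential_sub {f g : M → Euc n} {x : M}
    (hf : MDifferentiableAt 𝓘(ℝ, Euc m) 𝓘(ℝ, Euc n) f x)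
    (hg : MDifferentiableAt 𝓘(ℝ, Euc m) 𝓘(ℝ, Euc n) g x) :
    mapDifferential (m := m) (fun y => f y - g y) x =
      mapDifferential f x - mapDifferential g x := by
  unfold mapDifferential
  exact mfderiv_sub hf hg

lemma mapDifferential_comp {f : M → Euc n} {x : M} {Φ : Euc n → Euc n}
    (hΦ : ContDiff ℝ ∞ Φ) (hf : MDifferentiableAt 𝓘(ℝ, Euc m) 𝓘(ℝ, Euc n) f x) :
    mapDifferential (m := m) (fun y => Φ (f y)) x =
      (fderiv ℝ Φ (f x)).comp (mapDifferential f x) := by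
  unfold mapDifferential
  have h := mfderiv_comp x (I := 𝓘(ℝ, Euc m)) (I' := 𝓘(ℝ, Euc n)) (I'' := 𝓘(ℝ, Euc n)) (g := Φ)
    (hΦ.differentiable (by simp) (f x)).mdifferentiableAt hf
  rw [mfderiv_eq_fderiv] at h
  exact h

variable [RiemannianBundle (fun x : M => TangentSpace 𝓘(ℝ, Euc m) x)]

lemma sqrt_det_pullbackMetric_id (h : M → Euc n) (x : M)
    (b : OrthonormalBasis (Fin m) ℝ (TangentSpace 𝓘(ℝ, Euc m) x)) :
    √(pullbackMetric (m := m) (fun y : M => y) h x).det =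
      gramDensity (fun i => mapDifferential h x (b i)) := by
  have hid : mfderiv 𝓘(ℝ, Euc m) 𝓘(ℝ, Euc m) (fun y : M => y) x =
      ContinuousLinearMap.id ℝ (TangentSpace 𝓘(ℝ, Euc m) x) := mfderiv_id
  have h2 := gramDensity_comp_eq (mapDifferential (m := m) h x).toLinearMap b
    (stdOrthonormalBasis ℝ (TangentSpace 𝓘(ℝ, Euc m) x))
  simp only [ContinuousLinearMap.coe_coe] at h2
  rw [h2, gramDensity]
  congr 2
  ext i j
  simp only [pullbackMetric, hid, Matrix.of_apply, Matrix.add_apply, Matrix.gram_apply,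
    Matrix.one_apply]
  congr 1
  exact OrthonormalBasis.inner_eq_ite _ i j

variable [IsManifold 𝓘(ℝ, Euc m) ∞ M] [T2Space M] [SigmaCompactSpace M]
  [MeasurableSpace M] [BorelSpace M]
  [IsContMDiffRiemannianBundle 𝓘(ℝ, Euc m) ∞ (Euc m) (fun x : M => TangentSpace 𝓘(ℝ, Euc m) x)]

lemma exists_norm_fderiv_gramDensity_le (R : ℝ) : ∃ C : ℝ, 0 ≤ C ∧ ∀ a : Fin m → Euc n,
    ‖a‖ ≤ R → ‖fderiv ℝ gramDensity a‖ ≤ C := by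
  obtain ⟨C, hC⟩ := (isCompact_closedBall (0 : Fin m → Euc n) R).exists_bound_of_continuousOn
    (contDiff_gramDensity.continuous_fderiv (by simp)).continuousOn
  exact ⟨max C 0, le_max_right _ _, fun a ha => (hC a (by simpa using ha)).trans (le_max_left _ _)⟩

/-- The Euler-Lagrange equation of a minimal map in weak form. -/
lemma IsMinimalMap.integral_fderiv_gramDensity_eq_zero {D K : Set M} (hD : IsOpen D)
    {f η : M → Euc n} (hf : IsMinimalMap (m := m) D f)
    (hη : ContMDiffOn 𝓘(ℝ, Euc m) 𝓘(ℝ, Euc n) ∞ η D) (hK : IsCompact K) (hKD : K ⊆ D)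
    (hηK : ∀ x ∈ D \ K, η x = 0)
    (b : ∀ x : M, OrthonormalBasis (Fin m) ℝ (TangentSpace 𝓘(ℝ, Euc m) x)) {R : ℝ}
    (hfR : ∀ x ∈ D, ‖fun i => mapDifferential f x (b x i)‖ ≤ R)
    (hηR : ∀ x ∈ D, ‖fun i => mapDifferential η x (b x i)‖ ≤ R) :
    ∫ x in K, fderiv ℝ gramDensity (fun i => mapDifferential f x (b x i))
      (fun i => mapDifferential η x (b x i)) ∂(riemannianVolume m M) = 0 := by
  have := isFiniteMeasureOnCompacts_riemannianVolume (m := m) (M := M)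
  have hsm : ∀ t : ℝ, ContMDiffOn 𝓘(ℝ, Euc m) 𝓘(ℝ, Euc n) ∞ (fun x => f x + t • η x) D :=
    fun t => hf.smooth.add ((contMDiffOn_const (I' := 𝓘(ℝ, ℝ)) (c := t)).smul hη)
  have hdf : ∀ {g : M → Euc n}, ContMDiffOn 𝓘(ℝ, Euc m) 𝓘(ℝ, Euc n) ∞ g D → ∀ x ∈ D,
      MDifferentiableAt 𝓘(ℝ, Euc m) 𝓘(ℝ, Euc n) g x := fun hg x hx =>
    (hg.contMDiffAt (hD.mem_nhds hx)).mdifferentiableAt (by simp)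
  -- Vertical variations suffice: base points stay fixed, so the area integrand is `gramDensity` of
  -- the perturbed differential.
  have hvar : IsGraphVariation (m := m) D f K (fun _ x => x) (fun t x => f x + t • η x) := by
    refine ⟨hK, hKD, contMDiff_snd.contMDiffOn, ?_, fun x _ => ⟨rfl, by simp⟩,
      fun t x hx => ⟨rfl, by simp [hηK x hx]⟩⟩
    have h2 : MapsTo (Prod.snd : ℝ × M → M) (univ ×ˢ D) D := fun q hq => hq.2
    exact (hf.smooth.comp contMDiff_snd.contMDiffOn h2).add
      (contMDiff_fst.contMDiffOn.smul (hη.comp contMDiff_snd.contMDiffOn h2))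
  have hstat := hf.stationary K _ _ hvar
  set a : M → Fin m → Euc n := fun x i => mapDifferential f x (b x i)
  set e : M → Fin m → Euc n := fun x i => mapDifferential η x (b x i)
  have hline : ∀ t : ℝ, ∀ x ∈ D, (fun i => mapDifferential (fun y => f y + t • η y) x (b x i)) =
      a x + t • e x := fun t x hx => by
    rw [mapDifferential_add_smul (hdf hf.smooth x hx) (hdf hη x hx)]
    rfl
  have harea : (fun t : ℝ => mapArea (m := m) K (fun x => x) (fun x => f x + t • η x)) =
      fun t : ℝ => ∫ x in K, gramDensity (a x + t • e x) ∂(riemannianVolume m M) := by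
    ext t
    refine setIntegral_congr_fun hK.measurableSet fun x hx => ?_
    rw [sqrt_det_pullbackMetric_id _ x (b x), hline t x (hKD hx)]
  rw [harea] at hstat
  -- For |t| ≤ 1 the perturbed differential has norm at most R + R.
  obtain ⟨C, hC0, hC⟩ := exists_norm_fderiv_gramDensity_le (m := m) (n := n) (2 * R)
  have hmeas : ∀ t : ℝ, AEStronglyMeasurable (fun x => gramDensity (a x + t • e x))
      ((riemannianVolume m M).restrict K) := fun t => by
    refine ContinuousOn.aestronglyMeasurable ?_ hK.measurableSet
    refine ((continuousOn_comp_gramDensity b (α := fun x => mapDifferential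
      (fun y => f y + t • η y) x) fun c i =>
        continuousOn_mapDifferential_chartFrame hD (hsm t) c i).mono hKD).congr fun x hx => ?_
    rw [← hline t x (hKD hx)]
  have hcont0 : ContinuousOn (fun x => gramDensity (a x + (0 : ℝ) • e x)) K := by
    simp only [zero_smul, add_zero]
    exact (continuousOn_comp_gramDensity b fun c i =>
        continuousOn_mapDifferential_chartFrame hD hf.smooth c i).mono hKD
  have hmeas' : AEStronglyMeasurable (fun x => fderiv ℝ gramDensity (a x + (0 : ℝ) • e x) (e x))
      ((riemannianVolume m M).restrict K) := by
    simp only [zero_smul, add_zero]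
    exact ((continuousOn_comp_fderiv_gramDensity b
      (fun c i => continuousOn_mapDifferential_chartFrame hD hf.smooth c i)
      (fun c i => continuousOn_mapDifferential_chartFrame hD hη c i)).mono
        hKD).aestronglyMeasurable hK.measurableSet
  have hder := (hasDerivAt_integral_of_dominated_loc_of_deriv_le (μ := (riemannianVolume m M).restrict K)
    (F := fun (t : ℝ) x => gramDensity (a x + t • e x))
    (F' := fun t x => fderiv ℝ gramDensity (a x + t • e x) (e x)) (x₀ := (0 : ℝ))
    (bound := fun _ => C * R) (Metric.ball_mem_nhds 0 one_pos)
    (Eventually.of_forall hmeas) (hcont0.integrableOn_compact hK) hmeas' ?_ ?_ ?_).2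
  · have h0 := hder.unique hstat
    simpa only [zero_smul, add_zero] using h0
  · filter_upwards [ae_restrict_mem hK.measurableSet] with x hx t ht
    have hR : 0 ≤ R := (norm_nonneg _).trans (hfR x (hKD hx))
    have ht' : ‖t‖ ≤ 1 := by simpa using (Metric.mem_ball.1 ht).le
    refine (ContinuousLinearMap.le_opNorm _ _).trans (mul_le_mul (hC _ ?_) (hηR x (hKD hx))
      (norm_nonneg _) hC0)
    calc ‖a x + t • e x‖ ≤ ‖a x‖ + ‖t‖ * ‖e x‖ := (norm_add_le _ _).trans (by rw [norm_smul])
      _ ≤ R + 1 * R := add_le_add (hfR x (hKD hx))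
          (mul_le_mul ht' (hηR x (hKD hx)) (norm_nonneg _) zero_le_one)
      _ = 2 * R := by ring
  · exact integrableOn_const hK.measure_lt_top.ne
  · exact Eventually.of_forall fun x t _ => hasDerivAt_gramDensity_line' (a x) (e x) t

end FirstVariation

/-! ### From monotonicity to equality of the maps. -/

section Uniqueness

variable {m n : ℕ} {M : Type*} [TopologicalSpace M] [ChartedSpace (Euc m) M]
  [IsManifold 𝓘(ℝ, Euc m) ∞ M]

/-- A smooth map with vanishing differential on an open set is locally constant there. -/
lemma eventually_eq_of_mapDifferential_eq_zero {U : Set M} (hU : IsOpen U) {w : M → Euc n}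
    (hw : ContMDiffOn 𝓘(ℝ, Euc m) 𝓘(ℝ, Euc n) ∞ w U)
    (h0 : ∀ x ∈ U, mapDifferential (m := m) w x = 0) {x : M} (hx : x ∈ U) :
    ∀ᶠ y in 𝓝 x, w y = w x := by
  set φ := chartAt (Euc m) x
  have hxs : x ∈ φ.source := mem_chart_source _ x
  have hopen : IsOpen (φ.target ∩ φ.symm ⁻¹' U) := φ.isOpen_inter_preimage_symm hU
  have hxm : φ x ∈ φ.target ∩ φ.symm ⁻¹' U :=
    ⟨φ.map_source hxs, by rwa [mem_preimage, φ.left_inv hxs]⟩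
  obtain ⟨r, hr, hball⟩ := Metric.isOpen_iff.1 hopen (φ x) hxm
  have hcd : ContDiffOn ℝ ∞ (w ∘ φ.symm) (φ.target ∩ φ.symm ⁻¹' U) := by
    rw [← contMDiffOn_iff_contDiffOn]
    exact hw.comp (contMDiffOn_chart_symm.mono inter_subset_left) fun y hy => hy.2
  have hfd : EqOn (fderiv ℝ (w ∘ φ.symm)) 0 (Metric.ball (φ x) r) := fun y hy => by
    have hy' := hball hy
    have hs : MDifferentiableAt 𝓘(ℝ, Euc m) 𝓘(ℝ, Euc m) φ.symm y :=
      (contMDiffOn_chart_symm (n := ∞) (x := x)).contMDiffAt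
        (φ.open_target.mem_nhds hy'.1) |>.mdifferentiableAt (by simp)
    have hwd : MDifferentiableAt 𝓘(ℝ, Euc m) 𝓘(ℝ, Euc n) w (φ.symm y) :=
      (hw.contMDiffAt (hU.mem_nhds hy'.2)).mdifferentiableAt (by simp)
    have h1 := mfderiv_comp y hwd hs
    rw [mfderiv_eq_fderiv] at h1
    have h2 : mfderiv 𝓘(ℝ, Euc m) 𝓘(ℝ, Euc n) w (φ.symm y) = 0 := h0 _ hy'.2
    rw [h2] at h1
    refine h1.trans ?_
    exact ContinuousLinearMap.zero_comp _
  obtain ⟨a, ha⟩ := Metric.isOpen_ball.exists_is_const_of_fderiv_eq_zero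
    (convex_ball (φ x) r).isPreconnected
    ((hcd.mono hball).differentiableOn (by simp)) hfd
  have hcont : φ ⁻¹' Metric.ball (φ x) r ∈ 𝓝 x :=
    (φ.continuousAt hxs).preimage_mem_nhds (Metric.ball_mem_nhds _ hr)
  filter_upwards [hcont, φ.open_source.mem_nhds hxs] with y hy hys
  have e1 := ha _ hy
  have e2 := ha _ (Metric.mem_ball_self hr)
  simp only [Function.comp_apply, φ.left_inv hys, φ.left_inv hxs] at e1 e2
  rw [e1, e2]

/-- If `w` vanishes on the boundary of `D` and is locally constant where it is not zero, then it
vanishes on `D`. -/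
lemma eq_zero_of_eventually_eq {X W : Type*} [TopologicalSpace X] [TopologicalSpace W] [T1Space W]
    [Zero W] {D : Set X} (hD : IsOpen D) (hDconn : IsPreconnected D) (hDbd : (frontier D).Nonempty)
    {w : X → W} (hw : ContinuousOn w (closure D)) (hbd : ∀ x ∈ frontier D, w x = 0)
    (hloc : ∀ x ∈ D, w x ≠ 0 → ∀ᶠ y in 𝓝 x, w y = w x) {x : X} (hx : x ∈ D) : w x = 0 := by
  by_contra hne
  have hu : IsOpen (D ∩ w ⁻¹' {w x}) := by
    rw [isOpen_iff_mem_nhds]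
    intro y hy
    have hyx : w y = w x := hy.2
    filter_upwards [hD.mem_nhds hy.1, hloc y hy.1 (hyx ▸ hne)] with z hz hzy
    exact ⟨hz, hzy.trans hyx⟩
  have hv : IsOpen (D ∩ w ⁻¹' {w x}ᶜ) :=
    (hw.mono subset_closure).isOpen_inter_preimage hD isClosed_singleton.isOpen_compl
  have hsub := hDconn.subset_left_of_subset_union hu hv
    (disjoint_left.2 fun y hy hy' => hy'.2 hy.2)
    (fun y hy => by by_cases h : w y = w x; exacts [Or.inl ⟨hy, h⟩, Or.inr ⟨hy, h⟩])
    ⟨x, hx, hx, rfl⟩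
  -- The level set of w x is open and closed in D, hence all of D; by continuity the nonzero value
  -- then reaches a frontier point, where w = 0.
  have hcl : IsClosed (closure D ∩ w ⁻¹' {w x}) :=
    hw.preimage_isClosed_of_isClosed isClosed_closure isClosed_singleton
  have hDs : D ⊆ closure D ∩ w ⁻¹' {w x} := fun y hy => ⟨subset_closure hy, (hsub hy).2⟩
  have hcl' := closure_minimal hDs hcl
  obtain ⟨y, hy⟩ := hDbd
  exact hne ((hcl' (frontier_subset_closure hy)).2.symm.trans (hbd y hy))

variable [RiemannianBundle (fun x : M => TangentSpace 𝓘(ℝ, Euc m) x)] [T2Space M]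
  [SigmaCompactSpace M] [MeasurableSpace M] [BorelSpace M]
  [IsContMDiffRiemannianBundle 𝓘(ℝ, Euc m) ∞ (Euc m) (fun x : M => TangentSpace 𝓘(ℝ, Euc m) x)]

/-- The difference of two minimal maps with bounded differentials and equal boundary values is an
admissible test function. -/
lemma setIntegral_indicator_sub_eq_zero {D : Set M} (hD : IsOpen D)
    (hDcpt : IsCompact (closure D)) {f₀ f₁ : M → Euc n}
    (hc₀ : ContinuousOn f₀ (closure D)) (hc₁ : ContinuousOn f₁ (closure D))
    (hmin₀ : IsMinimalMap (m := m) D f₀) (hmin₁ : IsMinimalMap (m := m) D f₁)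
    (hbdry : EqOn f₀ f₁ (frontier D))
    (b : ∀ x : M, OrthonormalBasis (Fin m) ℝ (TangentSpace 𝓘(ℝ, Euc m) x)) {R : ℝ}
    (hR₀ : ∀ x ∈ D, ‖fun i => mapDifferential f₀ x (b x i)‖ ≤ R)
    (hR₁ : ∀ x ∈ D, ‖fun i => mapDifferential f₁ x (b x i)‖ ≤ R) :
    ∫ x in D, {x | f₁ x - f₀ x ≠ 0}.indicator (fun x =>
      (fderiv ℝ gramDensity (fun i => mapDifferential f₁ x (b x i)) -
        fderiv ℝ gramDensity (fun i => mapDifferential f₀ x (b x i)))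
      (fun i => mapDifferential (fun y => f₁ y - f₀ y) x (b x i))) x ∂(riemannianVolume m M) = 0 := by
  have := isFiniteMeasureOnCompacts_riemannianVolume (m := m) (M := M)
  by_cases hDe : D = ∅
  · simp [hDe]
  have hRn : 0 ≤ R := by
    obtain ⟨x, hx⟩ := nonempty_iff_ne_empty.2 hDe
    exact (norm_nonneg _).trans (hR₀ x hx)
  set w : M → Euc n := fun y => f₁ y - f₀ y
  have hws : ContMDiffOn 𝓘(ℝ, Euc m) 𝓘(ℝ, Euc n) ∞ w D := hmin₁.smooth.sub hmin₀.smooth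
  have hwc : ContinuousOn w (closure D) := hc₁.sub hc₀
  have hdf : ∀ {g : M → Euc n}, ContMDiffOn 𝓘(ℝ, Euc m) 𝓘(ℝ, Euc n) ∞ g D → ∀ x ∈ D,
      MDifferentiableAt 𝓘(ℝ, Euc m) 𝓘(ℝ, Euc n) g x := fun hg x hx =>
    (hg.contMDiffAt (hD.mem_nhds hx)).mdifferentiableAt (by simp)
  set e : M → Fin m → Euc n := fun x i => mapDifferential w x (b x i)
  have heR : ∀ x ∈ D, ‖e x‖ ≤ 2 * R := fun x hx => by
    have he : e x = (fun i => mapDifferential f₁ x (b x i)) -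
        fun i => mapDifferential f₀ x (b x i) := by
      simp only [e, w]
      rw [mapDifferential_sub (hdf hmin₁.smooth x hx) (hdf hmin₀.smooth x hx)]
      rfl
    rw [he, two_mul]
    exact (norm_sub_le _ _).trans (add_le_add (hR₁ x hx) (hR₀ x hx))
  obtain ⟨C, hC0, hC⟩ := exists_norm_fderiv_cutoffMap_le (W := Euc n)
  obtain ⟨C', hC'0, hC'⟩ := exists_norm_fderiv_gramDensity_le (m := m) (n := n) R
  set r : ℕ → ℝ := fun N => N + 1
  have hr : ∀ N, 0 < r N := fun N => by positivity
  -- The difference w is only continuous up to the frontier and need not have compact support in D.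
  -- Cutting off its small values gives smooth test maps vanishing where ‖w‖ ≤ 1 / r N.
  set η : ℕ → M → Euc n := fun N x => scaledCutoff (r N) (w x)
  have hηs : ∀ N, ContMDiffOn 𝓘(ℝ, Euc m) 𝓘(ℝ, Euc n) ∞ (η N) D := fun N =>
    (contDiff_scaledCutoff (r N)).contMDiff.comp_contMDiffOn hws
  have hηd : ∀ N, ∀ x ∈ D, (fun i => mapDifferential (η N) x (b x i)) =
      fun i => fderiv ℝ cutoffMap (r N • w x) (e x i) := fun N x hx => by
    simp only [η]
    rw [mapDifferential_comp (contDiff_scaledCutoff (r N)) (hdf hws x hx),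
      fderiv_scaledCutoff (hr N).ne']
    rfl
  have hηR : ∀ N, ∀ x ∈ D, ‖fun i => mapDifferential (η N) x (b x i)‖ ≤ C * (2 * R) :=
    fun N x hx => by
      rw [hηd N x hx, pi_norm_le_iff_of_nonneg (by positivity)]
      intro i
      exact (ContinuousLinearMap.le_opNorm _ _).trans (mul_le_mul (hC _)
        ((norm_le_pi_norm (e x) i).trans (heR x hx)) (norm_nonneg _) hC0)
  set X : M → (Fin m → Euc n) →L[ℝ] ℝ := fun x =>
    fderiv ℝ gramDensity (fun i => mapDifferential f₁ x (b x i)) -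
        fderiv ℝ gramDensity (fun i => mapDifferential f₀ x (b x i))
  have hcont : ∀ N {f : M → Euc n}, ContMDiffOn 𝓘(ℝ, Euc m) 𝓘(ℝ, Euc n) ∞ f D →
      ContinuousOn (fun x => fderiv ℝ gramDensity (fun i => mapDifferential f x (b x i))
        (fun i => mapDifferential (η N) x (b x i))) D := fun N f hf =>
    continuousOn_comp_fderiv_gramDensity b
      (fun c i => continuousOn_mapDifferential_chartFrame hD hf c i)
      (fun c i => continuousOn_mapDifferential_chartFrame hD (hηs N) c i)
  have hint : ∀ N, ∫ x in D, X x (fun i => mapDifferential (η N) x (b x i))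
      ∂(riemannianVolume m M) = 0 := fun N => by
    -- K is compact and avoids the frontier because w vanishes there.
    set K : Set M := closure D ∩ {x | 1 ≤ ‖r N • w x‖}
    have hKc : IsClosed K := (hwc.const_smul (r N)).norm.preimage_isClosed_of_isClosed
      isClosed_closure isClosed_Ici
    have hK : IsCompact K := hDcpt.of_isClosed_subset hKc inter_subset_left
    have hKD : K ⊆ D := fun x hx => by
      by_contra hxD
      have hfr : x ∈ frontier D := ⟨hx.1, by rwa [hD.interior_eq]⟩
      have h1 : 1 ≤ ‖r N • w x‖ := hx.2
      have h2 : w x = 0 := sub_eq_zero.2 (hbdry hfr).symm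
      rw [h2, smul_zero, norm_zero] at h1
      linarith
    have hout : ∀ x ∈ D \ K, ‖r N • w x‖ < 1 := fun x hx => by
      by_contra hc
      exact hx.2 ⟨subset_closure hx.1, not_lt.1 hc⟩
    have hηK : ∀ x ∈ D \ K, η N x = 0 := fun x hx => by
      simp only [η, scaledCutoff, cutoffMap_eq_zero (hout x hx).le, smul_zero]
    have hX : ∀ {f : M → Euc n}, IsMinimalMap (m := m) D f →
        (∀ x ∈ D, ‖fun i => mapDifferential f x (b x i)‖ ≤ R) →
        ∫ x in K, fderiv ℝ gramDensity (fun i => mapDifferential f x (b x i))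
          (fun i => mapDifferential (η N) x (b x i)) ∂(riemannianVolume m M) = 0 :=
      fun {f} hf hfR => hf.integral_fderiv_gramDensity_eq_zero hD (hηs N) hK hKD hηK b
        (R := max R (C * (2 * R))) (fun x hx => (hfR x hx).trans (le_max_left _ _))
        (fun x hx => (hηR N x hx).trans (le_max_right _ _))
    rw [setIntegral_eq_of_subset_of_forall_sdiff_eq_zero hD.measurableSet hKD]
    · simp only [X, _root_.sub_apply]
      rw [integral_sub, hX hmin₁ hR₁, hX hmin₀ hR₀, sub_zero]
      · exact ((hcont N hmin₁.smooth).mono hKD).integrableOn_compact hK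
      · exact ((hcont N hmin₀.smooth).mono hKD).integrableOn_compact hK
    · intro x hx
      rw [hηd N x hx.1, fderiv_cutoffMap_eq_zero (hout x hx)]
      exact (X x).map_zero
  have hlim : Tendsto (fun N => ∫ x in D, X x (fun i => mapDifferential (η N) x (b x i))
      ∂(riemannianVolume m M)) atTop (𝓝 (∫ x in D, {x | w x ≠ 0}.indicator (fun x => X x (e x)) x
        ∂(riemannianVolume m M))) := by
    refine tendsto_integral_of_dominated_convergence (fun _ => (C' + C') * (C * (2 * R)))
      (fun N => ?_) ?_ (fun N => ?_) ?_
    · refine ContinuousOn.aestronglyMeasurable ?_ hD.measurableSet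
      simp only [X, _root_.sub_apply]
      exact (hcont N hmin₁.smooth).sub (hcont N hmin₀.smooth)
    · exact integrableOn_const
        ((measure_mono subset_closure).trans_lt hDcpt.measure_lt_top).ne
    · filter_upwards [ae_restrict_mem hD.measurableSet] with x hx
      refine (ContinuousLinearMap.le_opNorm _ _).trans (mul_le_mul ?_ (hηR N x hx)
        (norm_nonneg _) (by positivity))
      exact (norm_sub_le _ _).trans (add_le_add (hC' _ (hR₁ x hx)) (hC' _ (hR₀ x hx)))
    · filter_upwards [ae_restrict_mem hD.measurableSet] with x hx
      by_cases hwx : w x = 0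
      -- At a zero of w every cutoff has vanishing differential, whether or not dw vanishes there;
      -- this is the origin of the indicator in the limit.
      · refine tendsto_const_nhds.congr fun N => ?_
        rw [indicator_of_notMem (by simpa using hwx), hηd N x hx, hwx, smul_zero,
          fderiv_cutoffMap_eq_zero (by simp)]
        exact (X x).map_zero.symm
      · rw [indicator_of_mem (by exact hwx)]
        have hlarge : ∀ᶠ N : ℕ in atTop, 2 < ‖r N • w x‖ := by
          have : Tendsto (fun N : ℕ => r N * ‖w x‖) atTop atTop :=
            (tendsto_atTop_add_const_right _ 1 tendsto_natCast_atTop_atTop).atTop_mul_const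
              (norm_pos_iff.2 hwx)
          filter_upwards [this.eventually_gt_atTop 2] with N hN
          rwa [norm_smul, Real.norm_of_nonneg (hr N).le]
        refine tendsto_const_nhds.congr' ?_
        filter_upwards [hlarge] with N hN
        rw [hηd N x hx, fderiv_cutoffMap_eq_id hN]
        rfl
  simp only [hint] at hlim
  exact tendsto_nhds_unique hlim tendsto_const_nhds

/-- Two minimal maps with bounded differentials and equal boundary values have the same
differential wherever they differ, provided that the differential of the area density is strictly
monotone on their differentials. -/
lemma mapDifferential_sub_eq_zero_of_ne {D : Set M} (hDopen : IsOpen D)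
    (hDcpt : IsCompact (closure D)) {f₀ f₁ : M → Euc n}
    (hc₀ : ContinuousOn f₀ (closure D)) (hc₁ : ContinuousOn f₁ (closure D))
    (hmin₀ : IsMinimalMap (m := m) D f₀) (hmin₁ : IsMinimalMap (m := m) D f₁)
    (hbdry : EqOn f₀ f₁ (frontier D))
    (b : ∀ x : M, OrthonormalBasis (Fin m) ℝ (TangentSpace 𝓘(ℝ, Euc m) x))
    (hR₀ : ∀ x ∈ D, ‖fun i => mapDifferential f₀ x (b x i)‖ ≤ 2)
    (hR₁ : ∀ x ∈ D, ‖fun i => mapDifferential f₁ x (b x i)‖ ≤ 2)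
    (hmon : ∀ x ∈ D, 0 ≤ (fderiv ℝ gramDensity (fun i => mapDifferential f₁ x (b x i)) -
        fderiv ℝ gramDensity (fun i => mapDifferential f₀ x (b x i)))
        (fun i => (mapDifferential (m := m) f₁ x - mapDifferential (m := m) f₀ x) (b x i)) ∧
      ((fderiv ℝ gramDensity (fun i => mapDifferential f₁ x (b x i)) -
        fderiv ℝ gramDensity (fun i => mapDifferential f₀ x (b x i)))
        (fun i => (mapDifferential (m := m) f₁ x - mapDifferential (m := m) f₀ x) (b x i)) = 0 →
        mapDifferential (m := m) f₁ x = mapDifferential f₀ x)) {x : M} (hx : x ∈ D)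
    (hne : f₁ x - f₀ x ≠ 0) : mapDifferential (m := m) (fun y => f₁ y - f₀ y) x = 0 := by
  have := isOpenPosMeasure_riemannianVolume (m := m) (M := M)
  have := isFiniteMeasureOnCompacts_riemannianVolume (m := m) (M := M)
  have hzero := setIntegral_indicator_sub_eq_zero hDopen hDcpt hc₀ hc₁ hmin₀ hmin₁ hbdry b hR₀ hR₁
  set w : M → Euc n := fun y => f₁ y - f₀ y with hw
  have hws : ContMDiffOn 𝓘(ℝ, Euc m) 𝓘(ℝ, Euc n) ∞ w D := hmin₁.smooth.sub hmin₀.smooth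
  have hwc : ContinuousOn w (closure D) := hc₁.sub hc₀
  have hdw : ∀ x ∈ D, mapDifferential (m := m) w x =
      mapDifferential f₁ x - mapDifferential f₀ x := fun x hx =>
    mapDifferential_sub
      ((hmin₁.smooth.contMDiffAt (hDopen.mem_nhds hx)).mdifferentiableAt (by simp))
      ((hmin₀.smooth.contMDiffAt (hDopen.mem_nhds hx)).mdifferentiableAt (by simp))
  set g : M → ℝ := fun x => (fderiv ℝ gramDensity (fun i => mapDifferential f₁ x (b x i)) -
    fderiv ℝ gramDensity (fun i => mapDifferential f₀ x (b x i)))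
      (fun i => mapDifferential w x (b x i)) with hg
  have hmono : ∀ x ∈ D, 0 ≤ g x ∧ (g x = 0 → mapDifferential (m := m) w x = 0) := fun x hx => by
    obtain ⟨h1, h2⟩ := hmon x hx
    simp only [hg, hdw x hx]
    refine ⟨h1, fun h0 => ?_⟩
    rw [h2 h0, sub_self]
  have hgc : ContinuousOn g D := by
    simp only [hg, _root_.sub_apply]
    exact (continuousOn_comp_fderiv_gramDensity b
      (fun c i => continuousOn_mapDifferential_chartFrame hDopen hmin₁.smooth c i)
      (fun c i => continuousOn_mapDifferential_chartFrame hDopen hws c i)).sub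
      (continuousOn_comp_fderiv_gramDensity b
      (fun c i => continuousOn_mapDifferential_chartFrame hDopen hmin₀.smooth c i)
      (fun c i => continuousOn_mapDifferential_chartFrame hDopen hws c i))
  have hUo : IsOpen (D ∩ {x | w x ≠ 0}) :=
    (hwc.mono subset_closure).isOpen_inter_preimage hDopen isClosed_singleton.isOpen_compl
  -- A nonnegative integrand with zero integral vanishes almost everywhere; continuity and
  -- positivity of the measure on open sets make this pointwise.
  have hgU : EqOn g 0 (D ∩ {x | w x ≠ 0}) := by
    obtain ⟨C, hC0, hC⟩ := exists_norm_fderiv_gramDensity_le (m := m) (n := n) 2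
    have hgb : ∀ x ∈ D, ‖g x‖ ≤ (C + C) * (2 + 2) := fun x hx => by
      refine (ContinuousLinearMap.le_opNorm _ _).trans (mul_le_mul ((norm_sub_le _ _).trans
        (add_le_add (hC _ (hR₁ x hx)) (hC _ (hR₀ x hx)))) ?_ (norm_nonneg _) (by positivity))
      rw [hdw x hx]
      exact (norm_sub_le (fun i => mapDifferential f₁ x (b x i)) _).trans
        (add_le_add (hR₁ x hx) (hR₀ x hx))
    have hUm := hUo.measurableSet
    have hgi : IntegrableOn g (D ∩ {x | w x ≠ 0}) (riemannianVolume m M) := by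
      refine Integrable.mono' (integrableOn_const (C := (C + C) * (2 + 2)) ?_)
        ((hgc.mono inter_subset_left).aestronglyMeasurable hUm) ?_
      · exact ((measure_mono (inter_subset_left.trans subset_closure)).trans_lt
          hDcpt.measure_lt_top).ne
      · filter_upwards [ae_restrict_mem hUm] with x hx using hgb x hx.1
    have hgz : ∫ x in D ∩ {x | w x ≠ 0}, g x ∂(riemannianVolume m M) = 0 := by
      rw [← hzero, ← inter_eq_self_of_subset_right (inter_subset_left (s := D) (t := {x | w x ≠ 0})),
        ← setIntegral_indicator hUm]
      refine setIntegral_congr_fun hDopen.measurableSet fun x hx => ?_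
      by_cases hwx : w x = 0
      · have h1 : x ∉ D ∩ {x | w x ≠ 0} := fun h => h.2 hwx
        have h2 : x ∉ {x | f₁ x - f₀ x ≠ 0} := fun h => h hwx
        rw [indicator_of_notMem h1, indicator_of_notMem h2]
      · have h1 : x ∈ D ∩ {x | w x ≠ 0} := ⟨hx, hwx⟩
        have h2 : x ∈ {x | f₁ x - f₀ x ≠ 0} := hwx
        rw [indicator_of_mem h1, indicator_of_mem h2]
    rw [setIntegral_eq_zero_iff_of_nonneg_ae
      ((ae_restrict_mem hUm).mono fun x hx => (hmono x hx.1).1) hgi] at hgz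
    exact Measure.eqOn_open_of_ae_eq hgz hUo (hgc.mono inter_subset_left) continuousOn_const
  exact (hmono x hx).2 (hgU ⟨hx, hne⟩)

end Uniqueness

/-! ### The linear algebra applied to differentials at a point. -/

section Pointwise

variable {m n : ℕ} {M : Type*} [TopologicalSpace M] [ChartedSpace (Euc m) M]
  [RiemannianBundle (fun x : M => TangentSpace 𝓘(ℝ, Euc m) x)]

lemma norm_mapDifferential_le_two {f : M → Euc n} {x : M}
    (b : OrthonormalBasis (Fin m) ℝ (TangentSpace 𝓘(ℝ, Euc m) x))
    (h : (∀ i : Fin m, mapSingularValue f x i ≤ 1) ∨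
      (∑ i : Fin m, mapSingularValue f x i ≤ 2) ∨
      (∑ i : Fin m, mapSingularValue f x i ^ 2 ≤ 2) ∨
      (∑ i : Fin m, √(1 + mapSingularValue f x i ^ 2) ≤ 2)) :
    ‖fun i => mapDifferential f x (b i)‖ ≤ 2 :=
  norm_comp_orthonormalBasis_le_two b (mapDifferential f x) h

lemma fderiv_gramDensity_mapDifferential_mono {f₀ f₁ : M → Euc n} {x : M}
    (b : OrthonormalBasis (Fin m) ℝ (TangentSpace 𝓘(ℝ, Euc m) x))
    (h : ((∀ i : Fin m, mapSingularValue f₀ x i ≤ 1) ∧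
        ∀ i : Fin m, mapSingularValue f₁ x i ≤ 1) ∨
      (∑ i : Fin m, mapSingularValue f₀ x i ≤ 2 ∧ ∑ i : Fin m, mapSingularValue f₁ x i ≤ 2) ∨
      (∑ i : Fin m, mapSingularValue f₀ x i ^ 2 ≤ 2 ∧
        ∑ i : Fin m, mapSingularValue f₁ x i ^ 2 ≤ 2) ∨
      (∑ i : Fin m, √(1 + mapSingularValue f₀ x i ^ 2) ≤ 2 ∧
        ∑ i : Fin m, √(1 + mapSingularValue f₁ x i ^ 2) ≤ 2)) :
    0 ≤ (fderiv ℝ gramDensity (fun i => mapDifferential f₁ x (b i)) -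
        fderiv ℝ gramDensity (fun i => mapDifferential f₀ x (b i)))
        (fun i => (mapDifferential (m := m) f₁ x - mapDifferential (m := m) f₀ x) (b i)) ∧
      ((fderiv ℝ gramDensity (fun i => mapDifferential f₁ x (b i)) -
        fderiv ℝ gramDensity (fun i => mapDifferential f₀ x (b i)))
        (fun i => (mapDifferential (m := m) f₁ x - mapDifferential (m := m) f₀ x) (b i)) = 0 →
        mapDifferential (m := m) f₁ x = mapDifferential f₀ x) :=
  fderiv_gramDensity_mono_clm b (mapDifferential f₀ x)
    (mapDifferential f₁ x) h

end Pointwise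

/-! ### The uniqueness theorem. -/

theorem mainTheorem2 {m n : ℕ} {M : Type*} [TopologicalSpace M] [T2Space M] [SigmaCompactSpace M]
    [MeasurableSpace M] [BorelSpace M] [ChartedSpace (Euc m) M] [IsManifold 𝓘(ℝ, Euc m) ∞ M]
    [RiemannianBundle (fun x : M => TangentSpace 𝓘(ℝ, Euc m) x)]
    [IsContMDiffRiemannianBundle 𝓘(ℝ, Euc m) ∞ (Euc m)
      (fun x : M => TangentSpace 𝓘(ℝ, Euc m) x)]
    (D : Set M) (hDopen : IsOpen D) (hDconn : IsConnected D) (hDcpt : IsCompact (closure D))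
    (hDbd : (frontier D).Nonempty)
    (f₀ f₁ : M → Euc n)
    (hc₀ : ContinuousOn f₀ (closure D)) (hc₁ : ContinuousOn f₁ (closure D))
    (hmin₀ : IsMinimalMap (m := m) D f₀) (hmin₁ : IsMinimalMap (m := m) D f₁)
    (hbdry : EqOn f₀ f₁ (frontier D))
    (hsing :
      (∀ f ∈ ({f₀, f₁} : Set (M → Euc n)), ∀ x ∈ D, ∀ i : Fin m, mapSingularValue f x i ≤ 1) ∨
      (∀ f ∈ ({f₀, f₁} : Set (M → Euc n)), ∀ x ∈ D, ∑ i : Fin m, mapSingularValue f x i ≤ 2) ∨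
      (∀ f ∈ ({f₀, f₁} : Set (M → Euc n)), ∀ x ∈ D, ∑ i : Fin m, mapSingularValue f x i ^ 2 ≤ 2) ∨
      (∀ f ∈ ({f₀, f₁} : Set (M → Euc n)), ∀ x ∈ D,
        ∑ i : Fin m, Real.sqrt (1 + mapSingularValue f x i ^ 2) ≤ 2)) :
    EqOn f₀ f₁ (closure D) := by
  simp only [mem_insert_iff, mem_singleton_iff, forall_eq_or_imp, forall_eq] at hsing
  let b : ∀ x : M, OrthonormalBasis (Fin m) ℝ (TangentSpace 𝓘(ℝ, Euc m) x) := fun x =>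
    (stdOrthonormalBasis ℝ (TangentSpace 𝓘(ℝ, Euc m) x)).reindex (finCongr (finrank_tangentSpace x))
  have hR₀ : ∀ x ∈ D, ‖fun i => mapDifferential f₀ x (b x i)‖ ≤ 2 := fun x hx =>
    norm_mapDifferential_le_two (b x) (hsing.imp (fun h => h.1 x hx)
      (Or.imp (fun h => h.1 x hx) (Or.imp (fun h => h.1 x hx) fun h => h.1 x hx)))
  have hR₁ : ∀ x ∈ D, ‖fun i => mapDifferential f₁ x (b x i)‖ ≤ 2 := fun x hx =>
    norm_mapDifferential_le_two (b x) (hsing.imp (fun h => h.2 x hx)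
      (Or.imp (fun h => h.2 x hx) (Or.imp (fun h => h.2 x hx) fun h => h.2 x hx)))
  have hdz : ∀ x ∈ D ∩ {x | f₁ x - f₀ x ≠ 0},
      mapDifferential (m := m) (fun y => f₁ y - f₀ y) x = 0 := fun x hx =>
    mapDifferential_sub_eq_zero_of_ne hDopen hDcpt hc₀ hc₁ hmin₀ hmin₁ hbdry b hR₀ hR₁
      (fun x hx => fderiv_gramDensity_mapDifferential_mono (b x)
        (hsing.imp (fun h => ⟨h.1 x hx, h.2 x hx⟩) (Or.imp (fun h => ⟨h.1 x hx, h.2 x hx⟩)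
          (Or.imp (fun h => ⟨h.1 x hx, h.2 x hx⟩) fun h => ⟨h.1 x hx, h.2 x hx⟩)))) hx.1 hx.2
  have hws : ContMDiffOn 𝓘(ℝ, Euc m) 𝓘(ℝ, Euc n) ∞ (fun y => f₁ y - f₀ y) D :=
    hmin₁.smooth.sub hmin₀.smooth
  have hwc : ContinuousOn (fun y => f₁ y - f₀ y) (closure D) := hc₁.sub hc₀
  have hUo : IsOpen (D ∩ {x | f₁ x - f₀ x ≠ 0}) :=
    (hwc.mono subset_closure).isOpen_inter_preimage hDopen isClosed_singleton.isOpen_compl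
  intro x hx
  by_cases hxD : x ∈ D
  · refine (sub_eq_zero.1 (eq_zero_of_eventually_eq hDopen hDconn.isPreconnected hDbd hwc
      (fun x hx => sub_eq_zero.2 (hbdry hx).symm) (fun x hx hne => ?_) hxD)).symm
    exact eventually_eq_of_mapDifferential_eq_zero hUo (hws.mono inter_subset_left) hdz ⟨hx, hne⟩
  · exact hbdry ⟨hx, by rwa [hDopen.interior_eq]⟩
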